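/- Let $E=\bigoplus_{i=1}^{l}M_{e_i}(\mathbb C)$ and $F=\bigoplus_{j=1}^{k}M_{f_j}(\mathbb C)$ be finite-dimensional $C^*$-algebras ($e_i,f_j\ge 1$) and let $\beta_0,\beta_1:E\to F$ be unital $^*$-homomorphisms. The associated unital one-dimensional NCCW complex is the $C^*$-algebra $$A(E,F,\beta_0,\beta_1)=\{(f,a)\in C([0,1],F)\oplus E:\ f(0)=\beta_0(a),\ f(1)=\beta_1(a)\}.$$ For $A=A(E,F,\beta_0,\beta_1)$ let $\mathrm{sp}(A)=\{\delta_1,\dots,\delta_l\}\sqcup\coprod_{j=1}^{k}[0,1]_j$ (topological disjoint union, the $\delta_i$ being isolated points). For $h=(f,a)\in A$ put $h(\delta_i)=a_i\in M_{e_i}(\mathbb C)$, the $i$-th component of $a$, and $h(t,j)=f(t)_j\in M_{f_j}(\mathbb C)$, the $j$-th component of $f(t)$. A $^*$-homomorphism $\varphi:A\to C([0,1],M_q(\mathbb C))$ is called an $n$-standard map if there are a partition $0=z_0<z_1<\dots<z_n=1$ and, for each $m=1,\dots,n$ and $I_m=[z_{m-1},z_m]$, a continuous map $u^{(m)}$ from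 $I_m$ to the unitary group of $M_q(\mathbb C)$ and finitely many continuous paths $\xi^{(m)}_1,\dots,\xi^{(m)}_{k(m)}:I_m\to \mathrm{sp}(A)$ such that, for all $h\in A$ and $t\in I_m$, $$\varphi(h)(t)=u^{(m)}(t)\,\mathrm{diag}\bigl(h(\xi^{(m)}_1(t)),\dots,h(\xi^{(m)}_{k(m)}(t)),0,\dots,0\bigr)\,u^{(m)}(t)^*,$$ where the number of zeros at the end, depending only on $m$ and possibly zero, makes this a $q\times q$ matrix. A $^*$-homomorphism $\varphi:A\to B$ into $B=A(E',F',\alpha_0,\alpha_1)$, where $F'=\bigoplus_{j=1}^{k'}M_{f'_j}(\mathbb C)$, is called an $n$-standard map if, for every $j=1,\dots,k'$, its composition with the projection $B\to C([0,1],M_{f'_j}(\mathbb C))$, $(f,a)\mapsto f_j$, is an $n$-standard map. **Theorem.** Let $A=A(E,F,\beta_0,\beta_1)$ and $B=A(E',F',\alpha_0,\alpha_1)$ be unital one-dimensional NCCW complexes as above, let $\phi:A\to B$ be a unital $^*$-homomorphism, let $\mathcal F\subset A$ be a finite set, and let $\epsilon>0$. Then there exist $n\in\mathbb N$ and a unital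 $n$-standard map $\psi:A\to B$ such that $\|\phi(h)-\psi(h)\|<\epsilon$ for all $h\in\mathcal F$, and such that $\psi$ is injective if $\phi$ is injective. -/

import Mathlib

/- Matrix algebras carry their `C⋆`-norm, i.e. the operator norm on Euclidean space. -/
open scoped Matrix.Norms.L2Operator

/-- The finite-dimensional `C⋆`-algebra `⨁ i, M_{d i}(ℂ)` (with the maximum norm). -/
abbrev FinDimCStar {k : ℕ} (d : Fin k → ℕ) : Type :=
  ∀ i, Matrix (Fin (d i)) (Fin (d i)) ℂ

/-- The data defining a unital one-dimensional noncommutative CW complex `A(E, F, β₀, β₁)`: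
finite-dimensional `C⋆`-algebras `E = ⨁ M_{e i}(ℂ)`, `F = ⨁ M_{f j}(ℂ)` and unital
`⋆`-homomorphisms `β₀, β₁ : E → F`. -/
structure NCCW where
  l : ℕ
  k : ℕ
  e : Fin l → ℕ
  f : Fin k → ℕ
  e_pos : ∀ i, 0 < e i
  f_pos : ∀ j, 0 < f j
  β₀ : FinDimCStar e →⋆ₐ[ℂ] FinDimCStar f
  β₁ : FinDimCStar e →⋆ₐ[ℂ] FinDimCStar f

namespace NCCW

/-- The `C⋆`-algebra `A(E, F, β₀, β₁)`, i.e. the pullback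
`{(f, a) ∈ C([0,1], F) ⊕ E : f(0) = β₀(a), f(1) = β₁(a)}`. -/
def alg (A : NCCW) :
    StarSubalgebra ℂ (C(unitInterval, FinDimCStar A.f) × FinDimCStar A.e) where
  carrier := {h | h.1 0 = A.β₀ h.2 ∧ h.1 1 = A.β₁ h.2}
  mul_mem' := by
    rintro x y ⟨hx0, hx1⟩ ⟨hy0, hy1⟩
    exact ⟨by simp [hx0, hy0], by simp [hx1, hy1]⟩
  add_mem' := by
    rintro x y ⟨hx0, hx1⟩ ⟨hy0, hy1⟩
    exact ⟨by simp [hx0, hy0], by simp [hx1, hy1]⟩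
  algebraMap_mem' := by
    intro c
    exact ⟨(AlgHomClass.commutes A.β₀ c).symm, (AlgHomClass.commutes A.β₁ c).symm⟩
  star_mem' := by
    rintro x ⟨hx0, hx1⟩
    exact ⟨by simp [hx0, map_star], by simp [hx1, map_star]⟩

/-- The space `sp(A) = Sp(E) ∪ ∐_j [0,1]_j`, a topological disjoint union: `Sum.inl i` is the
(isolated) point `δ_i` and `Sum.inr ⟨j, t⟩` is the point `(t, j)`. -/
abbrev sp (A : NCCW) : Type := Fin A.l ⊕ (Σ _ : Fin A.k, unitInterval)

/-- The dimension of the representation of `A` attached to a point of `sp(A)`. -/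
def dim (A : NCCW) : A.sp → ℕ
  | Sum.inl i => A.e i
  | Sum.inr x => A.f x.1

/-- The value `h(x)` of `h = (f, a) ∈ A` at a point `x` of `sp(A)`: `h(δ_i)` is the `i`-th
component of `a`, and `h(t, j)` is the `j`-th component of `f(t)`. -/
noncomputable def eval (A : NCCW) (h : A.alg) :
    (x : A.sp) → Matrix (Fin (A.dim x)) (Fin (A.dim x)) ℂ
  | Sum.inl i => h.1.2 i
  | Sum.inr x => h.1.1 x.2 x.1

/-- The natural projection `A → C([0,1], M_{f_j}(ℂ))`, `(f, a) ↦ f_j`. -/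
noncomputable def proj (A : NCCW) (j : Fin A.k) :
    A.alg →⋆ₐ[ℂ] C(unitInterval, Matrix (Fin (A.f j)) (Fin (A.f j)) ℂ) where
  toFun h := ⟨fun t => h.1.1 t j, (continuous_apply j).comp h.1.1.continuous⟩
  map_one' := rfl
  map_mul' _ _ := rfl
  map_zero' := rfl
  map_add' _ _ := rfl
  commutes' _ := rfl
  map_star' _ := rfl

end NCCW

/-- The `q × q` block diagonal matrix `diag(M 0, …, M (k - 1), 0_r)`, blocks in this order. -/
def blockDiagZero {q k r : ℕ} {d : Fin k → ℕ} (M : ∀ i, Matrix (Fin (d i)) (Fin (d i)) ℂ)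
    (hq : ∑ i, d i + r = q) : Matrix (Fin q) (Fin q) ℂ :=
  let ε : ((Σ i, Fin (d i)) ⊕ Fin r) ≃ Fin q :=
    (Equiv.sumCongr finSigmaFinEquiv (Equiv.refl (Fin r))).trans
      (finSumFinEquiv.trans (finCongr hq))
  Matrix.reindex ε ε (Matrix.fromBlocks (Matrix.blockDiagonal' M) 0 0 0)

namespace NCCW

/-- A `⋆`-homomorphism `φ : A → C([0,1], M_q(ℂ))` is an `n`-standard map if there are a partition
`0 = z 0 < z 1 < ⋯ < z n = 1` and, on every `I = [z m, z (m + 1)]`, a continuous unitary-valued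
`u` and continuous paths `ξ i : I → sp(A)` such that for all `h ∈ A` and `t ∈ I`
`φ(h)(t) = u(t) diag(h(ξ 0 t), …, h(ξ (k - 1) t), 0_r) u(t)⋆`. -/
def IsStandardInterval (A : NCCW) {q : ℕ} (n : ℕ)
    (φ : A.alg →⋆ₙₐ[ℂ] C(unitInterval, Matrix (Fin q) (Fin q) ℂ)) : Prop :=
  ∃ z : Fin (n + 1) → unitInterval, StrictMono z ∧ z 0 = 0 ∧ z (Fin.last n) = 1 ∧
    ∀ m : Fin n,
      ∃ (u : C(Set.Icc (z m.castSucc) (z m.succ), Matrix.unitaryGroup (Fin q) ℂ))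
        (k r : ℕ) (ξ : Fin k → C(Set.Icc (z m.castSucc) (z m.succ), A.sp))
        (hq : ∀ t, ∑ i, A.dim (ξ i t) + r = q),
        ∀ (h : A.alg) (t : Set.Icc (z m.castSucc) (z m.succ)),
          φ h t = (u t : Matrix (Fin q) (Fin q) ℂ) *
            blockDiagZero (fun i => A.eval h (ξ i t)) (hq t) *
            star (u t : Matrix (Fin q) (Fin q) ℂ)

/-- A `⋆`-homomorphism `φ : A → B` between one-dimensional NCCW complexes is an `n`-standard map
if all its components `A → C([0,1], M_{f'_j}(ℂ))` are. -/
def IsStandard (A B : NCCW) (n : ℕ) (φ : A.alg →⋆ₙₐ[ℂ] B.alg) : Prop :=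
  ∀ j : Fin B.k, A.IsStandardInterval n ((B.proj j).toNonUnitalStarAlgHom.comp φ)

end NCCW

/-! For each summand of `F'`, evaluating `φ` along the interval gives a continuous family `Φ t` of
unital representations of `A` on one fixed `ℂ^q`. By `exists_eq_model` every such representation is
unitarily a direct sum of evaluations at points of `sp(A)`, so it is `model θ x`, where the shape
`θ` (which components of `sp(A)` occur) ranges over a finite set and the parameter `x` (a unitary
and positions) over a compact space. The choice of `x` need not be continuous in `t`, but
compactness gives enough: for `t` near `s`, `Φ t` and `Φ s` have models of a common shape with close
parameters (`eventually_exists_model`). A short path of parameters then joins `Φ t` to `Φ s` through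
standard representations that stay close to the family.

A Lebesgue number makes this uniform: any two nearby `a`, `b` are joined through a common centre
`s`. Paths are glued where the representations agree, even if unitaries, positions or shapes jump
there, which is what a standard map permits. The glued family equals `Φ` at `0` and `1`, so together
with the unchanged `E'`-component of `φ` it again lands in `B`.

For injectivity, each grid cell begins with a small loop moving all positions across their
`η`-neighbourhoods (`exists_loop`). If `ψ h = 0`, then `h` vanishes within `η` of the spectrum of
`Φ` at every grid point. When `φ` is injective, these neighbourhoods cover all intervals of `sp(A)`:
functions supported in a short subinterval form an infinite-dimensional space, so a nonzero one has
image with zero `E'`-component, and its nonzero image is seen at a point of a fine grid. Hence `h`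
lives on the points `δ_i` alone. There `ψ` is within distance `1` of `φ` on finitely many minimal
projections, and an idempotent of norm less than `1` is zero (`eq_zero_of_fst_eq_zero`). -/

open scoped Topology InnerProductSpace

/-! ### Algebra and continuity of block diagonal matrices. -/

section BlockDiagZero

variable {q k r : ℕ} {d : Fin k → ℕ}

theorem blockDiagZero_mul (M N : ∀ i, Matrix (Fin (d i)) (Fin (d i)) ℂ)
    (hq : ∑ i, d i + r = q) :
    blockDiagZero (fun i => M i * N i) hq = blockDiagZero M hq * blockDiagZero N hq := by
  simp only [blockDiagZero, Matrix.reindex_apply]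
  rw [Matrix.submatrix_mul_equiv, Matrix.fromBlocks_multiply, Matrix.blockDiagonal'_mul]
  simp

theorem blockDiagZero_add (M N : ∀ i, Matrix (Fin (d i)) (Fin (d i)) ℂ)
    (hq : ∑ i, d i + r = q) :
    blockDiagZero (fun i => M i + N i) hq = blockDiagZero M hq + blockDiagZero N hq := by
  have h : (fun i => M i + N i) = M + N := rfl
  simp only [blockDiagZero, Matrix.reindex_apply]
  rw [h, Matrix.blockDiagonal'_add]
  ext a b
  simp only [Matrix.add_apply, Matrix.submatrix_apply]
  rw [← Matrix.add_apply, Matrix.fromBlocks_add]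
  simp

theorem blockDiagZero_smul_one (c : ℂ) (hq : ∑ i, d i + 0 = q) :
    blockDiagZero (fun i => c • (1 : Matrix (Fin (d i)) (Fin (d i)) ℂ)) hq = c • 1 := by
  have h : (fun i => c • (1 : Matrix (Fin (d i)) (Fin (d i)) ℂ)) =
      c • (1 : ∀ i, Matrix (Fin (d i)) (Fin (d i)) ℂ) := rfl
  have h0 : (0 : Matrix (Fin 0) (Fin 0) ℂ) = c • 1 := Subsingleton.elim _ _
  simp only [blockDiagZero, Matrix.reindex_apply]
  rw [h, Matrix.blockDiagonal'_smul, Matrix.blockDiagonal'_one, h0,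
    ← smul_zero (A := Matrix _ (Fin 0) ℂ) c, ← smul_zero (A := Matrix (Fin 0) _ ℂ) c,
    ← Matrix.fromBlocks_smul, Matrix.fromBlocks_one, Matrix.submatrix_smul]
  rw [Pi.smul_apply, Pi.smul_apply, Matrix.submatrix_one_equiv]

theorem blockDiagZero_star (M : ∀ i, Matrix (Fin (d i)) (Fin (d i)) ℂ)
    (hq : ∑ i, d i + r = q) :
    blockDiagZero (fun i => star (M i)) hq = star (blockDiagZero M hq) := by
  simp [blockDiagZero, Matrix.star_eq_conjTranspose, Matrix.blockDiagonal'_conjTranspose,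
    Matrix.fromBlocks_conjTranspose]

theorem blockDiagZero_eq_zero {M : ∀ i, Matrix (Fin (d i)) (Fin (d i)) ℂ}
    {hq : ∑ i, d i + r = q} (h : blockDiagZero M hq = 0) : M = 0 := by
  simp only [blockDiagZero] at h
  have h1 : Matrix.fromBlocks (Matrix.blockDiagonal' M) 0 0 (0 : Matrix (Fin r) (Fin r) ℂ) = 0 :=
    (Matrix.reindex _ _).injective (h.trans rfl)
  rw [← Matrix.fromBlocks_zero, Matrix.fromBlocks_inj] at h1
  rw [← Matrix.blockDiag'_blockDiagonal' M, h1.1, Matrix.blockDiag'_zero]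

theorem continuous_blockDiagZero {X : Type*} [TopologicalSpace X]
    {M : X → ∀ i, Matrix (Fin (d i)) (Fin (d i)) ℂ} (hM : Continuous M)
    (hq : ∑ i, d i + r = q) : Continuous fun x => blockDiagZero (M x) hq := by
  unfold blockDiagZero
  exact (Continuous.matrix_fromBlocks hM.matrix_blockDiagonal' continuous_const
    continuous_const continuous_const).matrix_reindex _ _

/-- Blocks are compared heterogeneously because the size at a point of `sp(A)` and the size attached
to its component are equal only propositionally. -/
theorem blockDiagZero_congr {d' : Fin k → ℕ} (hd : ∀ i, d i = d' i)
    {M : ∀ i, Matrix (Fin (d i)) (Fin (d i)) ℂ} {M' : ∀ i, Matrix (Fin (d' i)) (Fin (d' i)) ℂ}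
    (hM : ∀ i, M i ≍ M' i) (hq : ∑ i, d i + r = q) (hq' : ∑ i, d' i + r = q) :
    blockDiagZero M hq = blockDiagZero M' hq' := by
  obtain rfl : d = d' := funext hd
  obtain rfl : M = M' := funext fun i => eq_of_heq (hM i)
  rfl

end BlockDiagZero

/-! ### Points of `sp(A)`, shapes, parameters and model representations. -/

namespace NCCW

variable (A : NCCW)

/-- Evaluation at a point of `sp(A)` as a `⋆`-homomorphism. -/
noncomputable def evalHom (x : A.sp) :
    A.alg →⋆ₐ[ℂ] Matrix (Fin (A.dim x)) (Fin (A.dim x)) ℂ where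
  toFun h := A.eval h x
  map_one' := by cases x <;> rfl
  map_mul' _ _ := by cases x <;> rfl
  map_zero' := by cases x <;> rfl
  map_add' _ _ := by cases x <;> rfl
  commutes' _ := by cases x <;> rfl
  map_star' _ := by cases x <;> rfl

/-- The connected components of `sp(A)`. -/
abbrev Label : Type := Fin A.l ⊕ Fin A.k

/-- The dimension of the representations attached to the points of a component of `sp(A)`. -/
def labelDim : A.Label → ℕ := Sum.elim A.e A.f

/-- The point of a given component of `sp(A)` with parameter `s`. -/
def pt (c : A.Label) (s : unitInterval) : A.sp := Sum.map id (fun j => ⟨j, s⟩) c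

theorem dim_pt (c : A.Label) (s : unitInterval) : A.dim (A.pt c s) = A.labelDim c := by
  cases c <;> rfl

theorem exists_pt_eq (x : A.sp) : ∃ c s, A.pt c s = x := by
  rcases x with i | ⟨j, t⟩
  · exact ⟨Sum.inl i, 0, rfl⟩
  · exact ⟨Sum.inr j, t, rfl⟩

theorem continuous_pt (c : A.Label) : Continuous (A.pt c) := by
  cases c with
  | inl i => exact continuous_const
  | inr j =>
    exact continuous_inr.comp
      (continuous_sigmaMk (σ := fun _ : Fin A.k => unitInterval) (i := j))

/-- Evaluation at `A.pt c s`, with values in a matrix algebra that does not depend on `s`. -/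
noncomputable def cell : (c : A.Label) → (s : unitInterval) →
    A.alg →⋆ₐ[ℂ] Matrix (Fin (A.labelDim c)) (Fin (A.labelDim c)) ℂ
  | Sum.inl i, s => A.evalHom (A.pt (Sum.inl i) s)
  | Sum.inr j, s => A.evalHom (A.pt (Sum.inr j) s)

theorem cell_heq (c : A.Label) (s : unitInterval) (h : A.alg) :
    A.cell c s h ≍ A.eval h (A.pt c s) := by
  cases c <;> rfl

theorem continuous_cell (c : A.Label) (h : A.alg) : Continuous fun s => A.cell c s h := by
  cases c with
  | inl i => exact continuous_const
  | inr j => exact (continuous_apply j).comp h.1.1.continuous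

theorem cell_eq_zero_iff (c : A.Label) (s : unitInterval) (h : A.alg) :
    A.cell c s h = 0 ↔ A.eval h (A.pt c s) = 0 := by
  cases c <;> rfl

/-- The components of `sp(A)` met by the constituents of a unital representation of `A` on
`ℂ^q`. -/
abbrev Shape (q : ℕ) : Type :=
  Σ k : Fin (q + 1), {c : Fin k → A.Label // ∑ i, A.labelDim (c i) + 0 = q}

/-- Parameters of representations of a given shape: a unitary and the positions of the
constituents in their components. -/
abbrev Param (q : ℕ) : Type := Matrix.unitaryGroup (Fin q) ℂ × (Fin q → unitInterval)

variable {A}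

/-- The position parameter of the `i`-th constituent. -/
def Shape.pos {q : ℕ} (θ : A.Shape q) (s : Fin q → unitInterval) (i : Fin θ.1) : unitInterval :=
  s (Fin.castLE (Nat.le_of_lt_succ θ.1.2) i)

theorem Shape.continuous_pos {q : ℕ} (θ : A.Shape q) (i : Fin θ.1) :
    Continuous fun s => θ.pos s i := continuous_apply _

/-- The representation `h ↦ u diag(h(x 1), …, h(x k)) u⋆`. -/
noncomputable def model {q : ℕ} (θ : A.Shape q) (x : Param q) :
    A.alg →⋆ₐ[ℂ] Matrix (Fin q) (Fin q) ℂ where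
  toFun h := (x.1 : Matrix (Fin q) (Fin q) ℂ) *
    blockDiagZero (fun i => A.cell (θ.2.1 i) (θ.pos x.2 i) h) θ.2.2 *
    star (x.1 : Matrix (Fin q) (Fin q) ℂ)
  map_one' := by
    have := blockDiagZero_smul_one 1 θ.2.2
    simp only [one_smul] at this
    simp [this]
  map_mul' h h' := by
    simp only [map_mul, blockDiagZero_mul]
    have := Unitary.coe_star_mul_self x.1
    simp only [mul_assoc]
    rw [← mul_assoc (star (x.1 : Matrix (Fin q) (Fin q) ℂ)) x.1, this, one_mul]
  map_zero' := by
    have := blockDiagZero_smul_one 0 θ.2.2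
    simp only [zero_smul] at this
    simp [this]
  map_add' h h' := by
    have : (fun i => A.cell (θ.2.1 i) (θ.pos x.2 i) (h + h')) = fun i =>
        A.cell (θ.2.1 i) (θ.pos x.2 i) h + A.cell (θ.2.1 i) (θ.pos x.2 i) h' :=
      funext fun i => (A.cell (θ.2.1 i) (θ.pos x.2 i)).map_add' h h'
    rw [this, blockDiagZero_add, mul_add, add_mul]
  commutes' c := by
    have : (fun i => A.cell (θ.2.1 i) (θ.pos x.2 i) (algebraMap ℂ _ c)) = fun i => c • 1 :=
      funext fun i => ((A.cell (θ.2.1 i) (θ.pos x.2 i)).commutes' c).trans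
        (Algebra.algebraMap_eq_smul_one c)
    rw [this, blockDiagZero_smul_one, Algebra.algebraMap_eq_smul_one]
    simp
  map_star' h := by
    simp only [map_star, blockDiagZero_star]
    simp [mul_assoc]

theorem model_apply {q : ℕ} (θ : A.Shape q) (x : Param q) (h : A.alg) :
    model θ x h = (x.1 : Matrix (Fin q) (Fin q) ℂ) *
      blockDiagZero (fun i => A.cell (θ.2.1 i) (θ.pos x.2 i) h) θ.2.2 *
      star (x.1 : Matrix (Fin q) (Fin q) ℂ) := rfl

theorem continuous_model {q : ℕ} (θ : A.Shape q) (h : A.alg) :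
    Continuous fun x => model θ x h := by
  have h1 : Continuous fun x : Param q => (x.1 : Matrix (Fin q) (Fin q) ℂ) :=
    continuous_subtype_val.comp continuous_fst
  have h2 : Continuous fun x : Param q =>
      blockDiagZero (fun i => A.cell (θ.2.1 i) (θ.pos x.2 i) h) θ.2.2 :=
    continuous_blockDiagZero (continuous_pi fun i =>
      (A.continuous_cell _ h).comp ((θ.continuous_pos i).comp continuous_snd)) _
  exact (h1.mul h2).mul h1.star

/-- Conjugation by a unitary and the block diagonal embedding are injective, so the kernel is read
off from the spectrum. This turns vanishing along a loop of models into vanishing of `h` on the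
swept points. -/
theorem model_eq_zero_iff {q : ℕ} (θ : A.Shape q) (x : Param q) (h : A.alg) :
    model θ x h = 0 ↔ ∀ i, A.eval h (A.pt (θ.2.1 i) (θ.pos x.2 i)) = 0 := by
  simp only [← cell_eq_zero_iff]
  constructor
  · intro h0
    have h1 : blockDiagZero (fun i => A.cell (θ.2.1 i) (θ.pos x.2 i) h) θ.2.2 =
        star (x.1 : Matrix (Fin q) (Fin q) ℂ) * model θ x h * x.1 := by
      have := Unitary.coe_star_mul_self x.1
      rw [model_apply, mul_assoc, mul_assoc, this, mul_one, ← mul_assoc, this, one_mul]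
    rw [h0, mul_zero, zero_mul] at h1
    exact fun i => congrFun (blockDiagZero_eq_zero h1) i
  · intro h0
    have := blockDiagZero_smul_one 0 θ.2.2
    simp only [zero_smul] at this
    simp [model_apply, h0, this]

end NCCW

/-! ### Irreducible finite-dimensional representations of `A`. -/

/-- Schur's lemma: operators commuting with an irreducible representation are scalar. -/
theorem exists_eq_algebraMap_of_forall_commute {R V : Type*} [Ring R] [Algebra ℂ R]
    [AddCommGroup V] [Module ℂ V] [FiniteDimensional ℂ V] [Nontrivial V]
    (ρ : R →ₐ[ℂ] Module.End ℂ V)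
    (hρ : ∀ W : Submodule ℂ V, (∀ a, ∀ w ∈ W, ρ a w ∈ W) → W = ⊥ ∨ W = ⊤)
    (T : Module.End ℂ V) (hT : ∀ a, Commute T (ρ a)) :
    ∃ c : ℂ, T = algebraMap ℂ (Module.End ℂ V) c := by
  obtain ⟨c, hc⟩ := Module.End.exists_eigenvalue T
  refine ⟨c, ?_⟩
  have hinv : ∀ a, ∀ w ∈ T.eigenspace c, ρ a w ∈ T.eigenspace c := by
    intro a w hw
    rw [Module.End.mem_eigenspace_iff] at hw ⊢
    have := LinearMap.congr_fun (hT a).eq w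
    simp only [Module.End.mul_apply] at this
    rw [this, hw, map_smul]
  rcases hρ _ hinv with h | h
  · exact absurd h hc
  · ext v
    have hv : v ∈ T.eigenspace c := h ▸ Submodule.mem_top
    rw [Module.End.mem_eigenspace_iff] at hv
    rw [hv, Module.algebraMap_end_apply]

/-- A continuous vector-valued function is the product of a scalar function and a vector-valued
function that vanish wherever it does. -/
theorem ContinuousMap.exists_eq_smul {X F : Type*} [TopologicalSpace X] [NormedAddCommGroup F]
    [NormedSpace ℂ F] (G : C(X, F)) :
    ∃ (s : C(X, ℂ)) (G' : C(X, F)), (∀ t, G t = s t • G' t) ∧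
      ∀ t, G t = 0 → s t = 0 ∧ G' t = 0 := by
  -- The factors are `√‖G‖` and `G / √‖G‖`. The second has norm `√‖G‖`, so it is continuous at the
  -- zeros of `G` too.
  let r : X → ℝ := fun t => Real.sqrt ‖G t‖
  have hr : Continuous r := G.continuous.norm.sqrt
  have hr2 : ∀ t, r t * r t = ‖G t‖ := fun t => Real.mul_self_sqrt (norm_nonneg _)
  have hr0 : ∀ t, r t = 0 ↔ G t = 0 := fun t => by
    simp [r, Real.sqrt_eq_zero (norm_nonneg _)]
  have hn : ∀ t, ‖((r t : ℂ)⁻¹) • G t‖ = r t := by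
    intro t
    by_cases h : G t = 0
    · simp [h, (hr0 t).2 h]
    · have h' : r t ≠ 0 := fun e => h ((hr0 t).1 e)
      rw [norm_smul, norm_inv, Complex.norm_real, Real.norm_of_nonneg (Real.sqrt_nonneg _)]
      exact (congrArg ((r t)⁻¹ * ·) (hr2 t).symm).trans (inv_mul_cancel_left₀ h' _)
  have hc : Continuous fun t => ((r t : ℂ)⁻¹) • G t := by
    rw [continuous_iff_continuousAt]
    intro t
    by_cases h : r t = 0
    · have h0 : ((r t : ℂ)⁻¹) • G t = 0 := by simp [h]
      rw [ContinuousAt, h0, tendsto_zero_iff_norm_tendsto_zero]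
      simp only [hn]
      exact h ▸ hr.continuousAt.tendsto
    · have h' : (r t : ℂ) ≠ 0 := by exact_mod_cast h
      exact ((Complex.continuous_ofReal.comp hr).continuousAt.inv₀ h').smul
        G.continuous.continuousAt
  refine ⟨⟨fun t => (r t : ℂ), Complex.continuous_ofReal.comp hr⟩, ⟨_, hc⟩, fun t => ?_,
    fun t ht => ?_⟩
  · by_cases h : G t = 0
    · simp [h]
    · have h' : (r t : ℂ) ≠ 0 := by exact_mod_cast fun e => h ((hr0 t).1 e)
      simp [smul_smul, h']
  · simp [ht, (hr0 t).2 ht]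

namespace NCCW

variable {A : NCCW}

@[ext]
theorem alg_ext {h h' : A.alg} (h1 : ∀ t j, h.1.1 t j = h'.1.1 t j)
    (h2 : ∀ i, h.1.2 i = h'.1.2 i) : h = h' :=
  Subtype.ext (Prod.ext (ContinuousMap.ext fun t => funext fun j => h1 t j) (funext h2))

/-- The element of `A` given by a matrix-valued function on the `j`-th interval vanishing at the
end points. -/
noncomputable def blk (j : Fin A.k) (G : C(unitInterval, Matrix (Fin (A.f j)) (Fin (A.f j)) ℂ))
    (hG : G 0 = 0 ∧ G 1 = 0) : A.alg :=
  ⟨(⟨fun t => Pi.single j (G t), (continuous_single j).comp G.continuous⟩, 0), by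
    constructor
    · simp [hG.1]
    · simp [hG.2]⟩

/-- The central element of `A` given by a scalar function on the `j`-th interval vanishing at the
end points. -/
noncomputable def cen (j : Fin A.k) (g : C(unitInterval, ℂ)) (hg : g 0 = 0 ∧ g 1 = 0) : A.alg :=
  blk j ⟨fun t => g t • 1, by fun_prop⟩ (by simp [hg.1, hg.2])

theorem blk_fst_self (j : Fin A.k) (G) (hG) (t : unitInterval) :
    (blk (A := A) j G hG).1.1 t j = G t := Pi.single_eq_same _ _

theorem blk_fst_of_ne {j j' : Fin A.k} (G) (hG) (t : unitInterval) (h : j' ≠ j) :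
    (blk (A := A) j G hG).1.1 t j' = 0 := Pi.single_eq_of_ne h _

theorem mul_fst (h h' : A.alg) (t : unitInterval) (j : Fin A.k) :
    (h * h').1.1 t j = h.1.1 t j * h'.1.1 t j := rfl

theorem mul_snd (h h' : A.alg) (i : Fin A.l) : (h * h').1.2 i = h.1.2 i * h'.1.2 i := rfl

theorem add_fst (h h' : A.alg) (t : unitInterval) (j : Fin A.k) :
    (h + h').1.1 t j = h.1.1 t j + h'.1.1 t j := rfl

theorem add_snd (h h' : A.alg) (i : Fin A.l) : (h + h').1.2 i = h.1.2 i + h'.1.2 i := rfl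

theorem smul_fst (c : ℂ) (h : A.alg) (t : unitInterval) (j : Fin A.k) :
    (c • h).1.1 t j = c • h.1.1 t j := rfl

theorem smul_snd (c : ℂ) (h : A.alg) (i : Fin A.l) : (c • h).1.2 i = c • h.1.2 i := rfl

theorem sum_fst {ι : Type*} (s : Finset ι) (h : ι → A.alg) (t : unitInterval) (j : Fin A.k) :
    (∑ x ∈ s, h x).1.1 t j = ∑ x ∈ s, (h x).1.1 t j := by
  classical
  induction s using Finset.induction_on with
  | empty => simp
  | insert a s ha ih => rw [Finset.sum_insert ha, Finset.sum_insert ha, add_fst, ih]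

theorem sum_snd {ι : Type*} (s : Finset ι) (h : ι → A.alg) (i : Fin A.l) :
    (∑ x ∈ s, h x).1.2 i = ∑ x ∈ s, (h x).1.2 i := by
  classical
  induction s using Finset.induction_on with
  | empty => simp
  | insert a s ha ih => rw [Finset.sum_insert ha, Finset.sum_insert ha, add_snd, ih]

/-- An element of `A` supported on the `j`-th interval is determined by its values there. -/
theorem ext_of_blk {j : Fin A.k} {h h' : A.alg} (h1 : ∀ t, h.1.1 t j = h'.1.1 t j)
    (h2 : ∀ j', j' ≠ j → ∀ t, h.1.1 t j' = h'.1.1 t j') (h3 : h.1.2 = h'.1.2) : h = h' := by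
  refine alg_ext (fun t j' => ?_) (fun i => congrFun h3 i)
  by_cases e : j' = j
  · subst e; exact h1 t
  · exact h2 j' e t

theorem cen_fst_self (j : Fin A.k) (g) (hg) (t : unitInterval) :
    (cen (A := A) j g hg).1.1 t j = g t • 1 := blk_fst_self _ _ _ _

theorem cen_fst_of_ne {j j' : Fin A.k} (g) (hg) (t : unitInterval) (h : j' ≠ j) :
    (cen (A := A) j g hg).1.1 t j' = 0 := blk_fst_of_ne _ _ _ h

theorem cen_snd (j : Fin A.k) (g) (hg) : (cen (A := A) j g hg).1.2 = 0 := rfl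

theorem cen_commute (j : Fin A.k) (g) (hg) (h : A.alg) : Commute (cen j g hg) h := by
  refine ext_of_blk (j := j) (fun t => ?_) (fun j' hj' t => ?_) (funext fun i => ?_)
  · simp only [mul_fst, cen_fst_self]; simp
  · simp only [mul_fst, cen_fst_of_ne _ _ _ hj']; simp
  · simp only [mul_snd, cen_snd]; simp

/-- The product function is named through an equation so that two factorisations of one function can
be rewritten to the same element. -/
theorem cen_mul_cen (j : Fin A.k) {g g' g'' : C(unitInterval, ℂ)} (hg) (hg') (hg'')
    (h : g * g' = g'') :
    cen (A := A) j g hg * cen j g' hg' = cen j g'' hg'' := by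
  subst h
  refine ext_of_blk (j := j) (fun t => ?_) (fun j' hj' t => ?_) (funext fun i => ?_)
  · simp only [mul_fst, cen_fst_self]; simp [smul_smul, mul_comm]
  · simp only [mul_fst, cen_fst_of_ne _ _ _ hj']; simp
  · simp only [mul_snd, cen_snd]; simp

set_option synthInstance.maxHeartbeats 200000 in
/-- A representation that does not kill the functions on the `j`-th interval and on which they act
as scalars is supported at an interior point of that interval. -/
theorem exists_interior_point {V : Type*} [AddCommGroup V] [Module ℂ V] [Nontrivial V]
    (ρ : A.alg →ₐ[ℂ] Module.End ℂ V) (j : Fin A.k)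
    (hsc : ∀ g hg, ∃ c : ℂ, ρ (cen j g hg) = algebraMap ℂ (Module.End ℂ V) c)
    (g : C(unitInterval, ℂ)) (hg : g 0 = 0 ∧ g 1 = 0) (hne : ρ (cen j g hg) ≠ 0) :
    ∃ t : unitInterval, g t ≠ 0 ∧ ∀ h : A.alg, h.1.1 t j = 0 → ρ h = 0 := by
  have hinj : Function.Injective (algebraMap ℂ (Module.End ℂ V)) :=
    (algebraMap ℂ (Module.End ℂ V)).injective
  have hfg : ∀ f : C(unitInterval, ℂ), (f * g) 0 = 0 ∧ (f * g) 1 = 0 := by simp [hg.1, hg.2]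
  -- Multiplication by `g` makes any `f` vanish at the end points. The normalised functional `χ / χ
  -- 1` is then a character of `C([0,1])`, hence evaluation at some `t`.
  choose χ hχ using fun f : C(unitInterval, ℂ) => hsc (f * g) (hfg f)
  have h1 : χ 1 ≠ 0 := by
    intro h0
    apply hne
    have := hχ 1
    simpa [h0] using this
  have hmul : ∀ f f', χ (f * f') * χ 1 = χ f * χ f' := by
    intro f f'
    apply hinj
    rw [map_mul, map_mul, ← hχ, ← hχ, ← hχ, ← hχ, ← map_mul, ← map_mul]
    congr 1
    rw [cen_mul_cen j _ _ (hfg (f * f' * g)) (by ring),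
      cen_mul_cen j _ _ (hfg (f * f' * g)) (by ring)]
  have hadd : ∀ f f', χ (f + f') = χ f + χ f' := by
    intro f f'
    apply hinj
    rw [map_add, ← hχ, ← hχ, ← hχ, ← map_add]
    congr 1
    refine ext_of_blk (j := j) (fun t => ?_) (fun j' hj' t => ?_) (funext fun i => ?_)
    · simp only [add_fst, cen_fst_self]; simp [add_mul, add_smul]
    · simp only [add_fst, cen_fst_of_ne _ _ _ hj']; simp
    · simp only [add_snd, cen_snd]; simp
  have hsmul : ∀ (c : ℂ) f, χ (c • f) = c * χ f := by
    intro c f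
    apply hinj
    rw [map_mul, ← hχ, ← hχ, ← Algebra.smul_def, ← map_smul]
    congr 1
    refine ext_of_blk (j := j) (fun t => ?_) (fun j' hj' t => ?_) (funext fun i => ?_)
    · simp only [smul_fst, cen_fst_self]; simp [mul_assoc, smul_smul]
    · simp only [smul_fst, cen_fst_of_ne _ _ _ hj']; simp
    · simp only [smul_snd, cen_snd]; simp
  let ω : C(unitInterval, ℂ) →ₐ[ℂ] ℂ :=
    { toFun := fun f => χ f / χ 1
      map_one' := div_self h1
      map_mul' := fun f f' => by
        have := hmul f f'
        field_simp
        linear_combination this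
      map_zero' := by
        have h0 : χ 0 = 0 := by simpa using hadd 0 0
        rw [h0, zero_div]
      map_add' := fun f f' => by rw [hadd, add_div]
      commutes' := fun c => by
        rw [Algebra.algebraMap_eq_smul_one, hsmul, mul_div_assoc, div_self h1]
        simp }
  obtain ⟨t, ht⟩ := (WeakDual.CharacterSpace.continuousMapEval_bijective (X := unitInterval)
    (𝕜 := ℂ)).2 (WeakDual.CharacterSpace.equivAlgHom.symm ω)
  have hχt : ∀ f, χ f = f t * χ 1 := by
    intro f
    have h2 : f t = ω f := by
      rw [← WeakDual.CharacterSpace.continuousMapEval_apply_apply (X := unitInterval) (𝕜 := ℂ), ht]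
      rfl
    rw [h2]
    exact (div_mul_cancel₀ _ h1).symm
  refine ⟨t, fun h0 => h1 ?_, fun h hh => ?_⟩
  · have h2 : χ g = χ 1 * χ 1 := by
      apply hinj
      rw [map_mul, ← hχ, ← hχ, ← map_mul]
      congr 1
      rw [cen_mul_cen j _ _ (hfg g) (by ring)]
    rw [hχt g, h0, zero_mul] at h2
    simpa using h2.symm
  · let hpq : Fin (A.f j) → Fin (A.f j) → C(unitInterval, ℂ) := fun p q =>
      ⟨fun t => h.1.1 t j p q,
        ((continuous_apply j).comp h.1.1.continuous).matrix_elem p q⟩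
    let B : Fin (A.f j) → Fin (A.f j) → A.alg := fun p q =>
      blk j ⟨fun t => g t • Matrix.single p q 1, by fun_prop⟩ (by simp [hg.1, hg.2])
    -- Expanding `g² h` in matrix units puts each entry of `h` into a central factor, on which `ρ`
    -- is the scalar `h_pq(t) χ 1 = 0`. Then `χ 1 ≠ 0` gives `ρ h = 0`.
    have key : cen j (1 * g) (hfg 1) * cen j (1 * g) (hfg 1) * h =
        ∑ p, ∑ q, cen j (hpq p q * g) (hfg _) * B p q := by
      refine ext_of_blk (j := j) (fun t => ?_) (fun j' hj' t => ?_) (funext fun i => ?_)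
      · simp only [mul_fst, cen_fst_self, sum_fst, B, blk_fst_self]
        conv_lhs => rw [Matrix.matrix_eq_sum_single (h.1.1 t j)]
        simp only [Finset.mul_sum]
        refine Finset.sum_congr rfl fun p _ => Finset.sum_congr rfl fun q _ => ?_
        simp [hpq, smul_smul, mul_comm, mul_assoc]
      · simp only [mul_fst, cen_fst_of_ne _ _ _ hj', sum_fst]; simp
      · simp only [mul_snd, cen_snd, sum_snd]; simp
    have h2 := congrArg ρ key
    simp only [map_mul, map_sum, hχ] at h2
    have h3 : ∀ p q, χ (hpq p q) = 0 := fun p q => by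
      rw [hχt]
      simp [hpq, hh]
    simp only [h3, map_zero, zero_mul, Finset.sum_const_zero] at h2
    rw [← map_mul, ← Algebra.smul_def] at h2
    exact (smul_eq_zero.1 h2).resolve_left (mul_ne_zero h1 h1)

end NCCW

namespace NCCW

variable {A : NCCW}

theorem fst_zero (h : A.alg) : h.1.1 0 = A.β₀ h.1.2 := h.2.1

theorem fst_one (h : A.alg) : h.1.1 1 = A.β₁ h.1.2 := h.2.2

theorem proj_apply (j : Fin A.k) (h : A.alg) (t : unitInterval) :
    A.proj j h t = h.1.1 t j := rfl

/-- A representation that kills all scalar functions vanishing at the end points factors through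
`E`. -/
theorem map_eq_zero_of_snd_eq_zero {R : Type*} [Ring R] [Algebra ℂ R] (ρ : A.alg →ₐ[ℂ] R)
    (hz : ∀ j g hg, ρ (cen j g hg) = 0) (h : A.alg) (hh : h.1.2 = 0) : ρ h = 0 := by
  have h0 : ∀ j, A.proj j h 0 = 0 := fun j => by
    rw [proj_apply, fst_zero, hh, map_zero]; rfl
  have h1 : ∀ j, A.proj j h 1 = 0 := fun j => by
    rw [proj_apply, fst_one, hh, map_zero]; rfl
  -- Only scalar functions are known to be killed, so each component of `h` is split into a scalar
  -- function times a matrix function, both vanishing at the end points.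
  choose s G hG hs using fun j => (A.proj j h).exists_eq_smul
  have key : h = ∑ j, cen j (s j) ⟨(hs j 0 (h0 j)).1, (hs j 1 (h1 j)).1⟩ *
      blk j (G j) ⟨(hs j 0 (h0 j)).2, (hs j 1 (h1 j)).2⟩ := by
    refine alg_ext (fun t j => ?_) (fun i => ?_)
    · rw [sum_fst, Finset.sum_eq_single j]
      · rw [mul_fst, cen_fst_self, blk_fst_self, smul_one_mul, ← hG, proj_apply]
      · intro j' _ hj'
        rw [mul_fst, cen_fst_of_ne _ _ _ hj'.symm, zero_mul]
      · simp
    · rw [sum_snd, hh]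
      simp [cen_snd]
  rw [key, map_sum]
  exact Finset.sum_eq_zero fun j _ => by rw [map_mul, hz, zero_mul]

/-- The element of `A` that interpolates linearly between `β₀ a` and `β₁ a`. -/
noncomputable def interp (a : FinDimCStar A.e) : A.alg :=
  ⟨(⟨fun t => ((1 - t : ℝ) : ℂ) • A.β₀ a + ((t : ℝ) : ℂ) • A.β₁ a, by fun_prop⟩, a), by
    constructor <;> simp⟩

theorem interp_snd (a : FinDimCStar A.e) : (interp a).1.2 = a := rfl

/-- `interp` is not multiplicative, but identities in `E` may be checked on second components, since
the discrepancy lies in the kernel of `ρ`. -/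
theorem map_congr_of_snd_eq {R : Type*} [Ring R] [Algebra ℂ R] (ρ : A.alg →ₐ[ℂ] R)
    (hz : ∀ h : A.alg, h.1.2 = 0 → ρ h = 0) {h h' : A.alg} (hh : h.1.2 = h'.1.2) :
    ρ h = ρ h' := by
  rw [← sub_eq_zero, ← map_sub]
  exact hz _ (sub_eq_zero.2 hh)

set_option maxHeartbeats 2000000 in
/-- An irreducible representation that factors through `E` is supported at a point `δ_i`. -/
theorem exists_discrete_point {V : Type*} [AddCommGroup V] [Module ℂ V] [FiniteDimensional ℂ V]
    [Nontrivial V] (ρ : A.alg →ₐ[ℂ] Module.End ℂ V)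
    (hρ : ∀ W : Submodule ℂ V, (∀ a, ∀ w ∈ W, ρ a w ∈ W) → W = ⊥ ∨ W = ⊤)
    (hz : ∀ h : A.alg, h.1.2 = 0 → ρ h = 0) :
    ∃ i, ∀ h : A.alg, h.1.2 i = 0 → ρ h = 0 := by
  -- The units of the summands of `E` lift to elements that are central modulo the kernel and sum to
  -- one there. By Schur they act as scalars, and one of these is nonzero.
  have hsum : ∑ i, ρ (interp (Pi.single i 1)) = 1 := by
    rw [← map_sum, ← map_one ρ]
    refine map_congr_of_snd_eq ρ hz (funext fun i => ?_)
    rw [sum_snd]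
    simp only [interp_snd]
    rw [Finset.sum_eq_single i]
    · exact Pi.single_eq_same _ _
    · intro b _ hb
      exact Pi.single_eq_of_ne hb.symm _
    · simp
  obtain ⟨i, hi⟩ : ∃ i, ρ (interp (Pi.single i 1)) ≠ 0 := by
    by_contra! hcon
    rw [Finset.sum_eq_zero fun i _ => hcon i] at hsum
    exact zero_ne_one hsum
  have hcomm : ∀ h : A.alg, Commute (ρ (interp (Pi.single i 1))) (ρ h) := by
    intro h
    rw [commute_iff_eq, ← map_mul, ← map_mul]
    refine map_congr_of_snd_eq ρ hz (funext fun i' => ?_)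
    rw [mul_snd, mul_snd, interp_snd]
    by_cases e : i' = i
    · subst e; simp
    · simp [e]
  obtain ⟨c, hc⟩ :=
    exists_eq_algebraMap_of_forall_commute (R := A.alg) (V := V) ρ hρ _ hcomm
  have hc0 : c ≠ 0 := by
    rintro rfl
    exact hi (by rw [hc, map_zero])
  refine ⟨i, fun h hh => ?_⟩
  have h1 : ρ (interp (Pi.single i 1) * h) = 0 := by
    refine hz _ (funext fun i' => ?_)
    rw [mul_snd, interp_snd]
    by_cases e : i' = i
    · subst e; simp [hh]
    · simp [e]
  rw [map_mul, hc, ← Algebra.smul_def] at h1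
  exact (smul_eq_zero.1 h1).resolve_left hc0

/-- Irreducible finite-dimensional representations of `A` factor through the evaluation at a point
of `sp(A)` whose evaluation map is surjective. -/
theorem exists_point_of_irreducible {V : Type*} [AddCommGroup V] [Module ℂ V]
    [FiniteDimensional ℂ V] [Nontrivial V] (ρ : A.alg →ₐ[ℂ] Module.End ℂ V)
    (hρ : ∀ W : Submodule ℂ V, (∀ a, ∀ w ∈ W, ρ a w ∈ W) → W = ⊥ ∨ W = ⊤) :
    ∃ x : A.sp, Function.Surjective (A.evalHom x) ∧ ∀ h, A.evalHom x h = 0 → ρ h = 0 := by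
  by_cases hz : ∀ j g hg, ρ (cen j g hg) = 0
  · obtain ⟨i, hi⟩ := exists_discrete_point ρ hρ (map_eq_zero_of_snd_eq_zero ρ hz)
    refine ⟨Sum.inl i, fun M => ⟨interp (Pi.single i M), ?_⟩, hi⟩
    exact Pi.single_eq_same _ _
  · push Not at hz
    obtain ⟨j, g, hg, hne⟩ := hz
    obtain ⟨t, ht, hρt⟩ := exists_interior_point ρ j
      (fun g hg => exists_eq_algebraMap_of_forall_commute (R := A.alg) (V := V) ρ hρ _ fun h => by
        rw [commute_iff_eq, ← map_mul, ← map_mul, (cen_commute j g hg h).eq]) g hg hne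
    -- Since `g` vanishes at the end points and `g t ≠ 0`, the point `t` is interior, and rescaled
    -- matrix multiples of `g` take every value there.
    have hsurj : ∀ N : Matrix (Fin (A.f j)) (Fin (A.f j)) ℂ, ∃ h : A.alg, h.1.1 t j = N :=
      fun N => ⟨blk j ⟨fun s => g s • (g t)⁻¹ • N, g.continuous.smul continuous_const⟩
        (by simp [hg.1, hg.2]), by rw [blk_fst_self]; exact smul_inv_smul₀ ht N⟩
    exact ⟨Sum.inr ⟨j, t⟩, hsurj, hρt⟩

end NCCW

/-! ### Orthogonal decomposition of finite-dimensional representations. -/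

section Decomposition

variable {R X H : Type*} [Ring R] [StarRing R] [Algebra ℂ R] {d : X → ℕ}
  (ev : ∀ x, R →⋆ₐ[ℂ] Matrix (Fin (d x)) (Fin (d x)) ℂ)
  [NormedAddCommGroup H] [InnerProductSpace ℂ H] [CompleteSpace H]
  (π : R →⋆ₐ[ℂ] (H →L[ℂ] H))

/-- This is what makes orthogonal complements of invariant subspaces invariant and lifted matrix
units produce orthonormal vectors. -/
theorem inner_map_left (a : R) (v w : H) : ⟪π a v, w⟫_ℂ = ⟪v, π (star a) w⟫_ℂ := by
  rw [map_star, ContinuousLinearMap.star_eq_adjoint, ContinuousLinearMap.adjoint_inner_right]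

/-- A subspace on which a representation factors through a full matrix algebra contains a copy of
the standard representation of that algebra. -/
theorem exists_orthonormal_of_factors {V : Submodule ℂ H} (hV : V ≠ ⊥)
    (hinv : ∀ a, ∀ v ∈ V, π a v ∈ V) {x : X} (hx : Function.Surjective (ev x))
    (hker : ∀ a, ev x a = 0 → ∀ v ∈ V, π a v = 0) :
    ∃ b : Fin (d x) → H, Orthonormal ℂ b ∧ (∀ p, b p ∈ V) ∧ (Nonempty (Fin (d x))) ∧
      ∀ a p, π a (b p) = ∑ q, ev x a q p • b q := by
  have hcongr : ∀ a a', ev x a = ev x a' → ∀ v ∈ V, π a v = π a' v := by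
    intro a a' h v hv
    have := hker (a - a') (by rw [map_sub, h, sub_self]) v hv
    rwa [map_sub, sub_apply, sub_eq_zero] at this
  -- Lifts of the matrix units satisfy the matrix unit relations only modulo the kernel of the
  -- evaluation, which is enough on `V`. A unit vector `u` fixed by `w p₀ p₀` then yields the basis
  -- `π (w p p₀) u`.
  choose w hw using fun p q : Fin (d x) => hx (Matrix.single p q 1)
  obtain ⟨v, hv, hv0⟩ := V.ne_bot_iff.1 hV
  have hsum : ∑ p, π (w p p) v = v := by
    have h1 := hcongr (∑ p, w p p) 1 (by
      rw [map_sum, map_one]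
      simp only [hw, Matrix.sum_single_eq_diagonal, Matrix.diagonal_one]) v hv
    rw [map_sum, map_one, sum_apply] at h1
    exact h1
  obtain ⟨p₀, hp₀⟩ : ∃ p, π (w p p) v ≠ 0 := by
    by_contra! hcon
    exact hv0 (by rw [← hsum, Finset.sum_eq_zero fun p _ => hcon p])
  set u' := π (w p₀ p₀) v with hu'
  set u : H := ((‖u'‖ : ℂ)⁻¹) • u' with hu
  have huV : u ∈ V := V.smul_mem _ (hinv _ _ hv)
  have hu1 : ⟪u, u⟫_ℂ = 1 := by
    have h1 : ‖u‖ = 1 := norm_smul_inv_norm hp₀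
    rw [inner_self_eq_norm_sq_to_K, h1]
    simp
  have huu : π (w p₀ p₀) u = u := by
    rw [hu, map_smul, hu', ← mul_apply_eq_comp, ← map_mul]
    congr 1
    exact hcongr _ _ (by rw [map_mul, hw]; simp) v hv
  refine ⟨fun p => π (w p p₀) u, ?_, fun p => hinv _ _ huV, ⟨p₀⟩, fun a p => ?_⟩
  · rw [orthonormal_iff_ite]
    intro p q
    rw [inner_map_left, ← mul_apply_eq_comp, ← map_mul]
    by_cases hpq : p = q
    · subst hpq
      rw [hcongr (star (w p p₀) * w p p₀) (w p₀ p₀) (by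
        rw [map_mul, map_star, hw, hw, Matrix.star_eq_conjTranspose,
          Matrix.conjTranspose_single]; simp) u huV, huu, hu1, if_pos rfl]
    · rw [hker (star (w p p₀) * w q p₀) (by
        rw [map_mul, map_star, hw, hw, Matrix.star_eq_conjTranspose,
          Matrix.conjTranspose_single]
        simp [Matrix.single_mul_single_of_ne, hpq]) u huV, inner_zero_right,
        if_neg hpq]
  · have h1 := hcongr (a * w p p₀) (∑ q, ev x a q p • w q p₀) (by
      rw [map_mul, map_sum, hw]
      simp only [map_smul, hw]
      ext r s
      rw [Matrix.sum_apply]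
      by_cases hs : s = p₀
      · subst hs
        simp [Matrix.mul_single_apply_same, Matrix.single_apply]
      · rw [Matrix.mul_single_apply_of_ne _ _ _ _ _ hs]
        simp [Ne.symm hs]) u huV
    rw [map_mul, map_sum, sum_apply] at h1
    simp only [map_smul, smul_apply] at h1
    exact h1

/-- Minimal invariant subspaces carry irreducible representations. -/
theorem exists_point_of_minimal
    (hpt : ∀ (V : Submodule ℂ H) (ρ : R →ₐ[ℂ] Module.End ℂ V),
      Nontrivial V → (∀ W : Submodule ℂ V, (∀ a, ∀ w ∈ W, ρ a w ∈ W) → W = ⊥ ∨ W = ⊤) →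
      ∃ x, Function.Surjective (ev x) ∧ ∀ a, ev x a = 0 → ρ a = 0)
    (V : Submodule ℂ H) (hV : V ≠ ⊥) (hinv : ∀ a, ∀ v ∈ V, π a v ∈ V)
    (hmin : ∀ W ≤ V, (∀ a, ∀ v ∈ W, π a v ∈ W) → W = ⊥ ∨ W = V) :
    ∃ x, Function.Surjective (ev x) ∧ ∀ a, ev x a = 0 → ∀ v ∈ V, π a v = 0 := by
  let ρ : R →ₐ[ℂ] Module.End ℂ V :=
    { toFun := fun a => ((π a : H →ₗ[ℂ] H)).restrict (hinv a)
      map_one' := by ext v; simp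
      map_mul' := fun a b => by ext v; simp
      map_zero' := by ext v; simp
      map_add' := fun a b => by
        ext v
        exact congrArg (fun T : H →L[ℂ] H => T v) (map_add π a b)
      commutes' := fun c => by
        ext v
        exact congrArg (fun T : H →L[ℂ] H => T v) (AlgHomClass.commutes π c) }
  have hρ : ∀ a (v : V), ((ρ a v : V) : H) = π a v := fun _ _ => rfl
  obtain ⟨x, hx, hker⟩ := hpt V ρ (V.nontrivial_iff_ne_bot.2 hV) fun W hW => by
    rcases hmin (W.map V.subtype) (V.map_subtype_le W) (by
      rintro a _ ⟨w, hw, rfl⟩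
      exact ⟨ρ a w, hW a w hw, rfl⟩) with h | h
    · exact Or.inl (Submodule.map_injective_of_injective V.injective_subtype
        (h.trans (Submodule.map_bot _).symm))
    · refine Or.inr (eq_top_iff.2 fun v _ => ?_)
      obtain ⟨w, hw, hwv⟩ := h.ge v.2
      rwa [← Subtype.ext hwv]
  refine ⟨x, hx, fun a ha v hv => ?_⟩
  rw [← hρ a ⟨v, hv⟩, hker a ha]
  rfl

variable [FiniteDimensional ℂ H]

/-- A nonzero invariant subspace contains a minimal one. -/
theorem exists_minimal_invariant {M : Submodule ℂ H} (hM : M ≠ ⊥)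
    (hinv : ∀ a, ∀ v ∈ M, π a v ∈ M) :
    ∃ V ≤ M, V ≠ ⊥ ∧ (∀ a, ∀ v ∈ V, π a v ∈ V) ∧
      ∀ W ≤ V, (∀ a, ∀ v ∈ W, π a v ∈ W) → W = ⊥ ∨ W = V := by
  obtain ⟨V, ⟨hVM, hV, hVinv⟩, hmin⟩ := (wellFounded_lt (α := Submodule ℂ H)).has_min
    {V | V ≤ M ∧ V ≠ ⊥ ∧ ∀ a, ∀ v ∈ V, π a v ∈ V} ⟨M, le_rfl, hM, hinv⟩
  refine ⟨V, hVM, hV, hVinv, fun W hW hWinv => ?_⟩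
  by_cases h0 : W = ⊥
  · exact Or.inl h0
  · exact Or.inr (hW.lt_or_eq.resolve_left (hmin W ⟨hW.trans hVM, h0, hWinv⟩))

/-- An invariant subspace is an orthogonal sum of standard representations, if every minimal
invariant subspace factors through one of the given surjective evaluations. -/
theorem exists_orthonormal_decomposition
    (hpt : ∀ V : Submodule ℂ H, V ≠ ⊥ → (∀ a, ∀ v ∈ V, π a v ∈ V) →
      (∀ W ≤ V, (∀ a, ∀ v ∈ W, π a v ∈ W) → W = ⊥ ∨ W = V) →
      ∃ x, Function.Surjective (ev x) ∧ ∀ a, ev x a = 0 → ∀ v ∈ V, π a v = 0)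
    (M : Submodule ℂ H) (hinv : ∀ a, ∀ v ∈ M, π a v ∈ M) :
    ∃ (k : ℕ) (x : Fin k → X) (b : (Σ i, Fin (d (x i))) → H), Orthonormal ℂ b ∧
      Submodule.span ℂ (Set.range b) = M ∧ (∀ i, 0 < d (x i)) ∧
      ∀ a i p, π a (b ⟨i, p⟩) = ∑ q, ev (x i) a q p • b ⟨i, q⟩ := by
  induction hn : Module.finrank ℂ M using Nat.strong_induction_on generalizing M with
  | _ n ih =>
  by_cases hM : M = ⊥
  · refine ⟨0, Fin.elim0, fun y => y.1.elim0, ⟨fun y => y.1.elim0, fun y => y.1.elim0⟩, ?_,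
      fun i => i.elim0, fun _ i => i.elim0⟩
    rw [hM, Set.range_eq_empty, Submodule.span_empty]
  obtain ⟨V, hVM, hV, hVinv, hVmin⟩ := exists_minimal_invariant π hM hinv
  obtain ⟨x₀, hx₀, hker⟩ := hpt V hV hVinv hVmin
  obtain ⟨b₀, hb₀, hb₀V, ⟨p₀⟩, hπ₀⟩ := exists_orthonormal_of_factors ev π hV hVinv hx₀ hker
  set S := Submodule.span ℂ (Set.range b₀) with hS
  have hSM : S ≤ M := Submodule.span_le.2 (by rintro _ ⟨p, rfl⟩; exact hVM (hb₀V p))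
  have hSinv : ∀ a, ∀ v ∈ S, π a v ∈ S := by
    intro a v hv
    induction hv using Submodule.span_induction with
    | mem v hv =>
      obtain ⟨p, rfl⟩ := hv
      rw [hπ₀]
      exact S.sum_mem fun q _ => S.smul_mem _ (Submodule.subset_span ⟨q, rfl⟩)
    | zero => rw [map_zero]; exact S.zero_mem
    | add v w _ _ hv hw => rw [map_add]; exact S.add_mem hv hw
    | smul c v _ hv => rw [map_smul]; exact S.smul_mem _ hv
  have hinv' : ∀ a, ∀ v ∈ Sᗮ ⊓ M, π a v ∈ Sᗮ ⊓ M := by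
    rintro a v ⟨hv, hvM⟩
    refine ⟨fun w hw => ?_, hinv a v hvM⟩
    rw [← star_star a, ← inner_map_left]
    exact hv _ (hSinv _ _ hw)
  have hlt : Sᗮ ⊓ M < M := by
    refine lt_of_le_of_ne inf_le_right fun h => ?_
    have h1 : b₀ p₀ ∈ Sᗮ ⊓ M := h.ge (hVM (hb₀V p₀))
    have h2 := h1.1 (b₀ p₀) (Submodule.subset_span ⟨p₀, rfl⟩)
    rw [inner_self_eq_zero] at h2
    exact hb₀.ne_zero p₀ h2
  obtain ⟨k, x, b, hb, hbM, hpos, hπ⟩ :=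
    ih _ (hn ▸ Submodule.finrank_lt_finrank_of_lt hlt) _ hinv' rfl
  have hbS : ∀ y, b y ∈ Sᗮ := fun y => by
    have : b y ∈ Sᗮ ⊓ M := hbM ▸ Submodule.subset_span ⟨y, rfl⟩
    exact this.1
  have hb₀S : ∀ p, b₀ p ∈ S := fun p => Submodule.subset_span ⟨p, rfl⟩
  let x' : Fin (k + 1) → X := Fin.cons x₀ x
  let b' : (Σ i, Fin (d (x' i))) → H := fun y =>
    Fin.cases (motive := fun i => Fin (d (x' i)) → H) b₀ (fun i p => b ⟨i, p⟩) y.1 y.2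
  refine ⟨k + 1, x', b', ⟨?_, ?_⟩, ?_, ?_, ?_⟩
  · rintro ⟨i, p⟩
    induction i using Fin.cases with
    | zero => exact hb₀.1 p
    | succ i => exact hb.1 ⟨i, p⟩
  · rintro ⟨i, p⟩ ⟨j, q⟩ hne
    induction i using Fin.cases with
    | zero =>
      induction j using Fin.cases with
      | zero => exact hb₀.2 (fun h : p = q => hne (congrArg (Sigma.mk 0) h))
      | succ j => exact hbS ⟨j, q⟩ _ (hb₀S p)
    | succ i =>
      induction j using Fin.cases with
      | zero =>
        show ⟪b ⟨i, p⟩, b₀ q⟫_ℂ = 0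
        rw [← inner_conj_symm, hbS ⟨i, p⟩ _ (hb₀S q), map_zero]
      | succ j =>
        refine hb.2 (i := ⟨i, p⟩) (j := ⟨j, q⟩) fun h => hne ?_
        cases h
        rfl
  · have hr : Set.range b' = Set.range b₀ ∪ Set.range b := by
      ext v
      constructor
      · rintro ⟨⟨i, p⟩, rfl⟩
        induction i using Fin.cases with
        | zero => exact Or.inl ⟨p, rfl⟩
        | succ i => exact Or.inr ⟨⟨i, p⟩, rfl⟩
      · rintro (⟨p, rfl⟩ | ⟨⟨i, p⟩, rfl⟩)
        · exact ⟨⟨0, p⟩, rfl⟩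
        · exact ⟨⟨i.succ, p⟩, rfl⟩
    rw [hr, Submodule.span_union, hbM]
    exact Submodule.sup_orthogonal_inf_of_hasOrthogonalProjection hSM
  · intro i
    induction i using Fin.cases with
    | zero => exact p₀.pos
    | succ i => exact hpos i
  · intro a i p
    induction i using Fin.cases with
    | zero => exact hπ₀ a p
    | succ i => exact hπ a i p


/-- A unital matrix representation is unitarily equivalent to a direct sum of evaluations, if every
minimal invariant subspace factors through one of the given surjective evaluations. -/
theorem exists_unitary_decomposition {q : ℕ} (Φ : R →⋆ₐ[ℂ] Matrix (Fin q) (Fin q) ℂ)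
    (hpt : ∀ (V : Submodule ℂ (EuclideanSpace ℂ (Fin q))) (ρ : R →ₐ[ℂ] Module.End ℂ V),
      Nontrivial V → (∀ W : Submodule ℂ V, (∀ a, ∀ w ∈ W, ρ a w ∈ W) → W = ⊥ ∨ W = ⊤) →
      ∃ x, Function.Surjective (ev x) ∧ ∀ a, ev x a = 0 → ρ a = 0) :
    ∃ (k : ℕ) (x : Fin k → X) (hq : ∑ i, d (x i) + 0 = q), k ≤ q ∧
      ∃ U ∈ Matrix.unitaryGroup (Fin q) ℂ, ∀ h,
        Φ h = U * blockDiagZero (fun i => ev (x i) h) hq * star U := by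
  let π : R →⋆ₐ[ℂ] (EuclideanSpace ℂ (Fin q) →L[ℂ] EuclideanSpace ℂ (Fin q)) :=
    (Matrix.toEuclideanCLM (n := Fin q) (𝕜 := ℂ)).toStarAlgHom.comp Φ
  have hπ : ∀ h v a, π h v a = ∑ a', Φ h a a' * v a' := by
    intro h v a
    show (Matrix.toEuclideanCLM (n := Fin q) (𝕜 := ℂ) (Φ h) v).ofLp a = _
    rw [Matrix.ofLp_toEuclideanCLM]
    rfl
  obtain ⟨k, x, b, hb, hspan, hpos, hπb⟩ := exists_orthonormal_decomposition ev π
    (exists_point_of_minimal ev π hpt) ⊤ (fun _ _ _ => Submodule.mem_top)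
  let B := OrthonormalBasis.mk hb hspan.ge
  have hcard : ∑ i, d (x i) + 0 = q := by
    have h1 := Module.finrank_eq_card_basis B.toBasis
    rw [finrank_euclideanSpace_fin, Fintype.card_sigma] at h1
    simp only [Fintype.card_fin] at h1
    rw [add_zero, h1]
  -- All blocks have positive size, so at most `q` of them occur; this bound keeps the set of shapes
  -- finite.
  have hk : k ≤ q := by
    calc k = ∑ _i : Fin k, 1 := by simp
      _ ≤ ∑ i, d (x i) := Finset.sum_le_sum fun i _ => hpos i
      _ = q := hcard
  let ε : ((Σ i, Fin (d (x i))) ⊕ Fin 0) ≃ Fin q :=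
    (Equiv.sumCongr finSigmaFinEquiv (Equiv.refl (Fin 0))).trans
      (finSumFinEquiv.trans (finCongr hcard))
  let ε' : (Σ i, Fin (d (x i))) ≃ Fin q := (Equiv.sumEmpty _ _).symm.trans ε
  let B' := B.reindex ε'
  let U : Matrix (Fin q) (Fin q) ℂ := (EuclideanSpace.basisFun (Fin q) ℂ).toBasis.toMatrix B'
  have hU : U ∈ Matrix.unitaryGroup (Fin q) ℂ :=
    OrthonormalBasis.toMatrix_orthonormalBasis_mem_unitary _ _
  have hUb : ∀ a y, U a (ε' y) = b y a := by
    intro a y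
    simp [U, B', B, Module.Basis.toMatrix_apply]
  have key : ∀ h, Φ h * U = U * blockDiagZero (fun i => ev (x i) h) hcard := by
    intro h
    ext a c
    obtain ⟨⟨i, p⟩, rfl⟩ := ε'.surjective c
    have h1 : (Φ h * U) a (ε' ⟨i, p⟩) = π h (b ⟨i, p⟩) a := by
      rw [hπ, Matrix.mul_apply]
      simp only [hUb]
    have h2 : ∀ y z, blockDiagZero (fun i => ev (x i) h) hcard (ε' y) (ε' z) =
        Matrix.blockDiagonal' (fun i => ev (x i) h) y z := by
      intro y z
      show (Matrix.fromBlocks _ _ _ _) (ε.symm (ε (Sum.inl y))) (ε.symm (ε (Sum.inl z))) = _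
      rw [ε.symm_apply_apply, ε.symm_apply_apply, Matrix.fromBlocks_apply₁₁]
    rw [h1, hπb, Matrix.mul_apply, ← ε'.sum_comp, Fintype.sum_sigma, Finset.sum_eq_single i]
    · simp [h2, hUb, mul_comm]
    · intro i' _ hi'
      refine Finset.sum_eq_zero fun p' _ => ?_
      rw [h2, Matrix.blockDiagonal'_apply_ne _ _ _ hi', mul_zero]
    · simp
  refine ⟨k, x, hcard, hk, U, hU, fun h => ?_⟩
  rw [← key, mul_assoc, Unitary.mul_star_self_of_mem hU, mul_one]

end Decomposition

namespace NCCW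
variable {A : NCCW}

/-- Rephrasing by component and position makes the matrix size depend on the component alone, as the
shapes require. -/
theorem exists_cell_of_irreducible {V : Type*} [AddCommGroup V] [Module ℂ V]
    [FiniteDimensional ℂ V] [Nontrivial V] (ρ : A.alg →ₐ[ℂ] Module.End ℂ V)
    (hρ : ∀ W : Submodule ℂ V, (∀ a, ∀ w ∈ W, ρ a w ∈ W) → W = ⊥ ∨ W = ⊤) :
    ∃ x : A.Label × unitInterval, Function.Surjective (A.cell x.1 x.2) ∧
      ∀ a, A.cell x.1 x.2 a = 0 → ρ a = 0 := by
  obtain ⟨x, hx, hker⟩ := exists_point_of_irreducible ρ hρ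
  obtain ⟨c, s, rfl⟩ := A.exists_pt_eq x
  refine ⟨(c, s), ?_⟩
  cases c with
  | inl i => exact ⟨hx, hker⟩
  | inr j => exact ⟨hx, hker⟩

/-- Every unital representation of `A` on `ℂ^q` is unitarily equivalent to a direct sum of
evaluations at points of `sp(A)`. -/
theorem exists_eq_model {q : ℕ} (Φ : A.alg →⋆ₐ[ℂ] Matrix (Fin q) (Fin q) ℂ) :
    ∃ θ : A.Shape q, ∃ x, Φ = model θ x := by
  obtain ⟨k, x, hq, hk, U, hU, hΦ⟩ := exists_unitary_decomposition (R := A.alg)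
    (X := A.Label × unitInterval) (d := fun x => A.labelDim x.1) (fun x => A.cell x.1 x.2) Φ
    (fun _ ρ _ hρ => exists_cell_of_irreducible ρ hρ)
  let θ : A.Shape q := ⟨⟨k, Nat.lt_succ_of_le hk⟩, fun i => (x i).1, hq⟩
  -- Position vectors have length `q` for every shape; the entries beyond `k` are never read, so `0`
  -- is a dummy value.
  let s : Fin q → unitInterval := fun a => if h : (a : ℕ) < k then (x ⟨a, h⟩).2 else 0
  have hs : ∀ i, θ.pos s i = (x i).2 := fun i => dif_pos i.2
  refine ⟨θ, (⟨U, hU⟩, s), StarAlgHom.ext fun h => ?_⟩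
  rw [hΦ, model_apply]
  simp only [hs]
  rfl

end NCCW

/-! ### Compactness of the parameter space, short paths and loops. -/

instance compactSpace_unitaryGroup (q : ℕ) : CompactSpace (Matrix.unitaryGroup (Fin q) ℂ) := by
  have : ProperSpace (Matrix (Fin q) (Fin q) ℂ) := FiniteDimensional.proper ℂ _
  refine isCompact_iff_compactSpace.1 (Metric.isCompact_of_isClosed_isBounded
    (s := (Matrix.unitaryGroup (Fin q) ℂ : Set (Matrix (Fin q) (Fin q) ℂ))) ?_ ?_)
  · have : (Matrix.unitaryGroup (Fin q) ℂ : Set (Matrix (Fin q) (Fin q) ℂ)) =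
        {U | U * star U = 1} := by
      ext U
      exact Matrix.mem_unitaryGroup_iff
    rw [this]
    exact isClosed_eq (continuous_id.mul continuous_star) continuous_const
  · refine (Metric.isBounded_iff_subset_closedBall 0).2 ⟨1, fun U hU => ?_⟩
    rw [mem_closedBall_zero_iff]
    have h1 : ‖star U * U‖ = ‖U‖ * ‖U‖ := CStarRing.norm_star_mul_self
    rw [Matrix.mem_unitaryGroup_iff'.1 hU] at h1
    rcases subsingleton_or_nontrivial (Matrix (Fin q) (Fin q) ℂ) with h | h
    · rw [Subsingleton.elim U 0, norm_zero]; exact zero_le_one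
    · rw [CStarRing.norm_one] at h1
      nlinarith [norm_nonneg U]

namespace NCCW
variable {A : NCCW} {q : ℕ}

/-- Representations near `Φ s` in a continuous family have models near a model of `Φ s`. -/
theorem eventually_exists_model (Φ : unitInterval → A.alg →⋆ₐ[ℂ] Matrix (Fin q) (Fin q) ℂ)
    (hΦ : ∀ h, Continuous fun t => Φ t h) (s : unitInterval) {δ : ℝ} (hδ : 0 < δ) :
    ∀ᶠ t in 𝓝 s, ∃ θ x x', Φ t = model θ x ∧ Φ s = model θ x' ∧ dist x' x < δ := by
  by_contra hcon
  rw [Filter.not_eventually] at hcon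
  -- The models are chosen without any continuity in `t`. Along an ultrafilter on the bad set
  -- converging to `s`, the shape is eventually constant by finiteness and the parameters converge
  -- by compactness. The limit models `Φ s`, a contradiction.
  choose θ x hx using fun t => exists_eq_model (Φ t)
  have hne : (𝓝 s ⊓ Filter.principal {t | ¬ ∃ θ x x', Φ t = model θ x ∧ Φ s = model θ x' ∧
      dist x' x < δ}).NeBot := Filter.frequently_mem_iff_neBot.1 hcon
  let 𝒰 := Ultrafilter.of (𝓝 s ⊓ Filter.principal {t | ¬ ∃ θ x x', Φ t = model θ x ∧
    Φ s = model θ x' ∧ dist x' x < δ})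
  have h𝒰 := Ultrafilter.of_le (𝓝 s ⊓ Filter.principal {t | ¬ ∃ θ x x', Φ t = model θ x ∧
    Φ s = model θ x' ∧ dist x' x < δ})
  have hs : Filter.Tendsto id (𝒰 : Filter unitInterval) (𝓝 s) := h𝒰.trans inf_le_left
  have hbad : ∀ᶠ t in (𝒰 : Filter unitInterval), ¬ ∃ θ x x', Φ t = model θ x ∧
      Φ s = model θ x' ∧ dist x' x < δ :=
    h𝒰.trans inf_le_right (Filter.mem_principal_self _)
  obtain ⟨θ₀, hθ₀⟩ : ∃ θ₀, ∀ᶠ t in (𝒰 : Filter unitInterval), θ t = θ₀ := by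
    have := (Ultrafilter.finite_biUnion_mem_iff (f := 𝒰) (Set.finite_univ (α := A.Shape q))
      (s := fun θ₀ => {t | θ t = θ₀})).1 (Filter.mem_of_superset Filter.univ_mem
        fun t _ => by simp)
    obtain ⟨θ₀, -, h⟩ := this
    exact ⟨θ₀, h⟩
  obtain ⟨x', -, hx'⟩ := isCompact_univ.ultrafilter_le_nhds (𝒰.map x) (by simp)
  have hlim : Filter.Tendsto x (𝒰 : Filter unitInterval) (𝓝 x') := hx'
  have hs' : Φ s = model θ₀ x' := by
    refine StarAlgHom.ext fun h => ?_
    have h1 : Filter.Tendsto (fun t => Φ t h) (𝒰 : Filter unitInterval) (𝓝 (Φ s h)) :=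
      ((hΦ h).tendsto s).comp hs
    have h2 : Filter.Tendsto (fun t => model θ₀ (x t) h) (𝒰 : Filter unitInterval)
        (𝓝 (model θ₀ x' h)) := ((continuous_model θ₀ h).tendsto x').comp hlim
    refine tendsto_nhds_unique (h1.congr' ?_) h2
    filter_upwards [hθ₀] with t ht
    rw [hx t, ht]
  obtain ⟨t, h1, h2, h3⟩ := (hbad.and (hθ₀.and (hlim (Metric.ball_mem_nhds x' hδ)))).exists
  exact h1 ⟨θ₀, x t, x', h2 ▸ hx t, hs', by rw [dist_comm]; exact h3⟩

/-- The models of a given size are equicontinuous on finite sets. -/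
theorem exists_forall_model_sub_lt {𝓕 : Set A.alg} (h𝓕 : 𝓕.Finite) {ε : ℝ} (hε : 0 < ε) :
    ∃ δ > 0, ∀ (θ : A.Shape q) (x x' : Param q), dist x' x < δ →
      ∀ h ∈ 𝓕, ‖model θ x' h - model θ x h‖ < ε := by
  -- Working with all small `δ` replaces a minimum over the finitely many shapes and elements of
  -- `𝓕`; each single modulus is uniform continuity on a compact space.
  have h1 : ∀ᶠ δ in 𝓝[>] (0 : ℝ), ∀ θ : A.Shape q, ∀ h ∈ 𝓕, ∀ x x' : Param q,
      dist x' x < δ → ‖model θ x' h - model θ x h‖ < ε := by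
    rw [Filter.eventually_all]
    intro θ
    rw [Filter.eventually_all_finite h𝓕]
    intro h _
    obtain ⟨δ, hδ, H⟩ := Metric.uniformContinuous_iff.1
      (CompactSpace.uniformContinuous_of_continuous (continuous_model θ h)) ε hε
    filter_upwards [Ioo_mem_nhdsGT hδ] with δ' hδ' x x' hx
    rw [← dist_eq_norm]
    exact H (hx.trans hδ'.2)
  obtain ⟨δ, H, hδ⟩ := (h1.and self_mem_nhdsWithin).exists
  exact ⟨δ, hδ, fun θ x x' hx h hh => H θ h hh x x' hx⟩

/-- Close parameters are joined by a short path. -/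
theorem exists_short_path {x x' : Param q} {δ : ℝ} (hδ : δ < 2) (h : dist x' x < δ) :
    ∃ γ : C(unitInterval, Param q), γ 0 = x ∧ γ 1 = x' ∧ ∀ t, dist (γ t) x < δ := by
  have hδ0 : 0 < δ := dist_nonneg.trans_lt h
  have h1 : dist x'.1 x.1 < δ := (le_max_left _ _).trans_lt h
  have h2 : dist x'.2 x.2 < δ := (le_max_right _ _).trans_lt h
  -- Balls of radius less than `2` in the unitary group are path connected; the positions move along
  -- straight segments.
  obtain ⟨p, hp⟩ := (Unitary.isPathConnected_ball x.1 δ hδ0 hδ).joinedIn x.1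
    (Metric.mem_ball_self hδ0) x'.1 h1
  have hmem : ∀ (t : unitInterval) (i : Fin q),
      (1 - (t : ℝ)) * x.2 i + t * x'.2 i ∈ unitInterval := by
    intro t i
    have ha := (x.2 i).2; have hb := (x'.2 i).2
    exact convex_Icc 0 1 ha hb (sub_nonneg.2 t.2.2) t.2.1 (by ring)
  refine ⟨⟨fun t => (p t, fun i => ⟨(1 - (t : ℝ)) * x.2 i + t * x'.2 i, hmem t i⟩), ?_⟩,
    ?_, ?_, fun t => ?_⟩
  · exact p.continuous.prodMk (continuous_pi fun i => by fun_prop)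
  · refine Prod.ext p.source (funext fun i => Subtype.ext ?_)
    simp
  · refine Prod.ext p.target (funext fun i => Subtype.ext ?_)
    simp
  · refine max_lt (hp t) ((dist_pi_lt_iff hδ0).2 fun i => ?_)
    have h3 := (dist_le_pi_dist x'.2 x.2 i).trans_lt h2
    rw [Subtype.dist_eq, Real.dist_eq] at h3 ⊢
    have h4 : (1 - (t : ℝ)) * x.2 i + t * x'.2 i - x.2 i = t * (x'.2 i - x.2 i) := by ring
    show |(1 - (t : ℝ)) * x.2 i + t * x'.2 i - x.2 i| < δ
    rw [h4, abs_mul, abs_of_nonneg t.2.1]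
    exact (mul_le_of_le_one_left (abs_nonneg _) t.2.2).trans_lt h3

/-- A small loop of parameters whose positions sweep out an interval. -/
theorem exists_loop (x : Param q) {η : ℝ} (hη : 0 < η) :
    ∃ γ : C(unitInterval, Param q), γ 0 = x ∧ γ 1 = x ∧ (∀ t, dist (γ t) x ≤ η) ∧
      ∀ i (s : unitInterval), |(s : ℝ) - x.2 i| ≤ η → ∃ t, (γ t).2 i = s := by
  -- The sine starts and ends at `0` and takes all values in `[-1, 1]`, so scaling by `η` and
  -- clamping to `[0, 1]` sweeps every position's neighbourhood. The unitary stays fixed.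
  let f : unitInterval → ℝ := fun t => Real.sin (2 * Real.pi * t)
  have hf : Continuous f := by fun_prop
  refine ⟨⟨fun t => (x.1, fun i => Set.projIcc 0 1 zero_le_one (x.2 i + η * f t)), ?_⟩,
    ?_, ?_, fun t => ?_, fun i s hs => ?_⟩
  · exact continuous_const.prodMk (continuous_pi fun i => continuous_projIcc.comp
      (continuous_const.add (continuous_const.mul hf)))
  · refine Prod.ext rfl (funext fun i => ?_)
    simp [f, Set.projIcc_val]
  · refine Prod.ext rfl (funext fun i => ?_)
    simp [f, Set.projIcc_val]
  · refine max_le (by simp [hη.le]) ((dist_pi_le_iff hη.le).2 fun i => ?_)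
    conv_lhs => rw [← Set.projIcc_val (zero_le_one (α := ℝ)) (x.2 i)]
    refine (((LipschitzWith.projIcc (zero_le_one (α := ℝ))).dist_le_mul _ _)).trans ?_
    rw [Real.dist_eq]
    simp only [NNReal.coe_one, one_mul, add_sub_cancel_left, abs_mul, abs_of_pos hη]
    exact mul_le_of_le_one_right hη.le (Real.abs_sin_le_one _)
  · have h1 : (s - x.2 i) / η ∈ Set.Icc (-1 : ℝ) 1 := by
      rw [abs_le] at hs
      rw [Set.mem_Icc, le_div_iff₀ hη, div_le_iff₀ hη]
      constructor <;> linarith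
    let a : unitInterval := ⟨1 / 4, by norm_num, by norm_num⟩
    let b : unitInterval := ⟨3 / 4, by norm_num, by norm_num⟩
    have hab : a ≤ b := Subtype.coe_le_coe.1 (by norm_num [a, b])
    have ha : f a = 1 := by
      have : 2 * Real.pi * (1 / 4) = Real.pi / 2 := by ring
      simp only [f, a, this, Real.sin_pi_div_two]
    have hb : f b = -1 := by
      have : 2 * Real.pi * (3 / 4) = Real.pi / 2 + Real.pi := by ring
      simp only [f, b, this, Real.sin_add_pi, Real.sin_pi_div_two]
    obtain ⟨t, -, ht⟩ := intermediate_value_Icc' hab hf.continuousOn (ha.symm ▸ hb.symm ▸ h1)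
    refine ⟨t, ?_⟩
    show Set.projIcc 0 1 zero_le_one (x.2 i + η * f t) = s
    rw [ht, mul_div_cancel₀ _ hη.ne', add_sub_cancel, Set.projIcc_val]

end NCCW

/-! ### Standard approximation of a continuous family of representations. -/

namespace NCCW
variable {A : NCCW} {q : ℕ}

/-- A path of models of a fixed shape. -/
abbrev Piece (A : NCCW) (q : ℕ) : Type := A.Shape q × C(unitInterval, Param q)

/-- The representation at time `t` of a path of models. -/
noncomputable def Piece.rep (P : Piece A q) (t : unitInterval) :
    A.alg →⋆ₐ[ℂ] Matrix (Fin q) (Fin q) ℂ := model P.1 (P.2 t)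

/-- The zero set of `h` contains an `η`-neighbourhood of a point of the support of `g`, whenever
`g` does not vanish in the representation `Φ`. -/
def Sweeps (η : ℝ) (Φ : A.alg →⋆ₐ[ℂ] Matrix (Fin q) (Fin q) ℂ) (h : A.alg) : Prop :=
  ∀ g : A.alg, Φ g ≠ 0 → ∃ c s, A.eval g (A.pt c s) ≠ 0 ∧
    ∀ s' : unitInterval, |(s' : ℝ) - s| ≤ η → A.eval h (A.pt c s') = 0

/-- Nearby members of a continuous family of representations are joined by three paths of models
that stay close to the family; the first of them is a loop. -/
theorem exists_pieces (Φ : unitInterval → A.alg →⋆ₐ[ℂ] Matrix (Fin q) (Fin q) ℂ)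
    (hΦ : ∀ h, Continuous fun t => Φ t h) {𝓕 : Set A.alg} (h𝓕 : 𝓕.Finite) {ε : ℝ}
    (hε : 0 < ε) :
    ∃ η > 0, ∃ τ > 0, ∀ a b : unitInterval, dist b a < τ → ∃ P : ℕ → Piece A q,
      (P 0).rep 0 = Φ a ∧ (P 0).rep 1 = (P 1).rep 0 ∧ (P 1).rep 1 = (P 2).rep 0 ∧
      (P 2).rep 1 = Φ b ∧
      (∀ r < 3, ∀ t c, dist c a < τ → ∀ h ∈ 𝓕, ‖(P r).rep t h - Φ c h‖ < ε) ∧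
      ∀ h, (∀ t, (P 0).rep t h = 0) → Sweeps η (Φ a) h := by
  have hε4 : 0 < ε / 4 := by positivity
  obtain ⟨δ₀, hδ₀, hmod⟩ := exists_forall_model_sub_lt (q := q) h𝓕 hε4
  set δ := min δ₀ 1 with hδ_def
  have hδ : 0 < δ := lt_min hδ₀ one_pos
  have hδ2 : δ < 2 := (min_le_right _ _).trans_lt (by norm_num)
  have hδδ₀ : δ ≤ δ₀ := min_le_left _ _
  let N : unitInterval → Set unitInterval := fun s =>
    {t | (∃ θ x x', Φ t = model θ x ∧ Φ s = model θ x' ∧ dist x' x < δ) ∧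
      ∀ h ∈ 𝓕, ‖Φ t h - Φ s h‖ < ε / 4}
  have hnhds : ∀ s, N s ∈ 𝓝 s := by
    intro s
    refine Filter.inter_mem (eventually_exists_model Φ hΦ s hδ) ?_
    refine (Filter.eventually_all_finite h𝓕).2 fun h _ => ?_
    have := ((hΦ h).tendsto s).eventually (Metric.ball_mem_nhds _ hε4)
    filter_upwards [this] with t ht
    rwa [← dist_eq_norm]
  -- The sets `N s` are only known to be neighbourhoods of `s`, so the open cover consists of their
  -- interiors. The Lebesgue number puts `a`, `b` and every comparison point `c` in one `N s`.
  obtain ⟨τ, hτ, hball⟩ := lebesgue_number_lemma_of_metric (c := fun s => interior (N s))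
    isCompact_univ (fun _ => isOpen_interior)
    (fun s _ => Set.mem_iUnion.2 ⟨s, mem_interior_iff_mem_nhds.2 (hnhds s)⟩)
  refine ⟨δ / 2, by positivity, τ, hτ, fun a b hab => ?_⟩
  obtain ⟨s, hs'⟩ := hball a (Set.mem_univ a)
  have hs : Metric.ball a τ ⊆ N s := hs'.trans interior_subset
  obtain ⟨⟨θ₁, x₁, y₁, hx₁, hy₁, hxy₁⟩, ha⟩ := hs (Metric.mem_ball_self hτ)
  obtain ⟨⟨θ₂, x₂, y₂, hx₂, hy₂, hxy₂⟩, -⟩ := hs hab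
  obtain ⟨γ₀, h00, h01, h0d, h0s⟩ := exists_loop x₁ (half_pos hδ)
  obtain ⟨γ₁, h10, h11, h1d⟩ := exists_short_path hδ2 hxy₁
  obtain ⟨γ₂, h20, h21, h2d⟩ := exists_short_path hδ2 (dist_comm y₂ x₂ ▸ hxy₂)
  refine ⟨fun r => match r with
    | 0 => (θ₁, γ₀)
    | 1 => (θ₁, γ₁)
    | _ => (θ₂, γ₂), ?_, ?_, ?_, ?_, ?_, ?_⟩
  · simp only [Piece.rep, h00, hx₁]
  · simp only [Piece.rep, h01, h10]
  -- The parameters `y₁`, `y₂` and even their shapes may differ; the pieces meet because both model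
  -- `Φ s`.
  · simp only [Piece.rep, h11, h20, ← hy₁, ← hy₂]
  · simp only [Piece.rep, h21, hx₂]
  · intro r hr t c hc h hh
    have hcs := (hs hc).2 h hh
    have has := ha h hh
    have tri : ∀ w z : Matrix (Fin q) (Fin q) ℂ, ‖w - z‖ < ε / 4 → ‖z - Φ s h‖ < ε / 4 →
        ‖w - Φ c h‖ < ε := by
      intro w z h1 h2
      -- Three errors below `ε / 4`: along the path to its reference representation `z`, from `z` to
      -- the centre, and from the centre to `Φ c`.
      have e : w - Φ c h = (w - z) + (z - Φ s h) - (Φ c h - Φ s h) := by abel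
      have := norm_sub_le ((w - z) + (z - Φ s h)) (Φ c h - Φ s h)
      have := norm_add_le (w - z) (z - Φ s h)
      rw [e]
      linarith
    interval_cases r
    · refine tri _ (Φ a h) ?_ has
      rw [hx₁]
      exact hmod θ₁ x₁ (γ₀ t) (((h0d t).trans_lt (half_lt_self hδ)).trans_le hδδ₀) h hh
    · refine tri _ (Φ a h) ?_ has
      rw [hx₁]
      exact hmod θ₁ x₁ (γ₁ t) ((h1d t).trans_le hδδ₀) h hh
    · refine tri _ (Φ s h) ?_ (by simpa using hε4)
      rw [hy₂]
      exact hmod θ₂ y₂ (γ₂ t) ((h2d t).trans_le hδδ₀) h hh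
  · intro h hh g hg
    rw [hx₁, Ne, model_eq_zero_iff] at hg
    push Not at hg
    obtain ⟨i, hi⟩ := hg
    refine ⟨_, _, hi, fun s' hs' => ?_⟩
    obtain ⟨t, ht⟩ := h0s _ s' hs'
    have : A.eval h (A.pt (θ₁.2.1 i) (θ₁.pos (γ₀ t).2 i)) = 0 :=
      (model_eq_zero_iff _ _ _).1 (hh t) i
    rwa [show θ₁.pos (γ₀ t).2 i = s' from ht] at this

/-- Paths of models with matching ends can be concatenated. -/
theorem exists_concat (P : ℕ → Piece A q) (hP : ∀ i, (P i).rep 1 = (P (i + 1)).rep 0) (n : ℕ) :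
    ∃ Ψ : ℝ → A.alg →⋆ₐ[ℂ] Matrix (Fin q) (Fin q) ℂ, (∀ h, Continuous fun t => Ψ t h) ∧
      Ψ n = (P n).rep 0 ∧ ∀ i < n, ∀ t ∈ Set.Icc (i : ℝ) (i + 1),
        Ψ t = (P i).rep (Set.projIcc 0 1 zero_le_one (t - i)) := by
  induction n with
  -- The family lives on all of `ℝ`; its constant value before time `0` only serves to start the
  -- induction.
  | zero => exact ⟨fun _ => (P 0).rep 0, fun _ => continuous_const, rfl, by simp⟩
  | succ n ih =>
    obtain ⟨Ψ, hc, hn, hi⟩ := ih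
    have hcont : ∀ h, Continuous fun t : ℝ =>
        (P n).rep (Set.projIcc 0 1 zero_le_one (t - n)) h := fun h =>
      (continuous_model (P n).1 h).comp ((P n).2.continuous.comp
        (continuous_projIcc.comp (continuous_id.sub continuous_const)))
    have hstart : (P n).rep (Set.projIcc 0 1 zero_le_one ((n : ℝ) - n)) = (P n).rep 0 := by
      simp
    refine ⟨fun t => if t ≤ n then Ψ t else
      (P n).rep (Set.projIcc 0 1 zero_le_one (t - n)), fun h => ?_, ?_, fun i hin t ht => ?_⟩
    · have : (fun t : ℝ => (if t ≤ n then Ψ t else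
          (P n).rep (Set.projIcc 0 1 zero_le_one (t - n))) h) = fun t : ℝ => if t ≤ n then Ψ t h
          else (P n).rep (Set.projIcc 0 1 zero_le_one (t - n)) h := by
        ext1 t
        split_ifs <;> rfl
      rw [this]
      refine Continuous.if_le (hc h) (hcont h) continuous_id continuous_const ?_
      rintro t rfl
      show Ψ _ h = _
      rw [hn, hstart]
    · have hlt : ¬ ((n + 1 : ℕ) : ℝ) ≤ n := by push_cast; linarith
      show (if _ then _ else _) = _
      rw [if_neg hlt, ← hP]
      simp
    · rcases Nat.lt_succ_iff_lt_or_eq.1 hin with h | rfl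
      · have h1 : (i : ℝ) + 1 ≤ n := by exact_mod_cast h
        show (if _ then _ else _) = _
        rw [if_pos (ht.2.trans h1), hi i h t ht]
      · show (if _ then _ else _) = _
        split_ifs with h
        · obtain rfl : t = i := le_antisymm h ht.1
          rw [hn, hstart]
        · rfl

/-- A family of representations that is, on every interval of some partition into `n` intervals,
unitarily equivalent to a direct sum of evaluations along continuous paths. -/
def IsStandardFamily (n : ℕ) (Ψ : unitInterval → A.alg →⋆ₐ[ℂ] Matrix (Fin q) (Fin q) ℂ) : Prop :=
  ∃ z : Fin (n + 1) → unitInterval, StrictMono z ∧ z 0 = 0 ∧ z (Fin.last n) = 1 ∧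
    ∀ m : Fin n,
      ∃ (u : C(Set.Icc (z m.castSucc) (z m.succ), Matrix.unitaryGroup (Fin q) ℂ))
        (k r : ℕ) (ξ : Fin k → C(Set.Icc (z m.castSucc) (z m.succ), A.sp))
        (hq : ∀ t, ∑ i, A.dim (ξ i t) + r = q),
        ∀ (h : A.alg) (t : Set.Icc (z m.castSucc) (z m.succ)),
          Ψ t h = (u t : Matrix (Fin q) (Fin q) ℂ) *
            blockDiagZero (fun i => A.eval h (ξ i t)) (hq t) *
            star (u t : Matrix (Fin q) (Fin q) ℂ)

/-- On each interval of the uniform partition the parameter path of the piece supplies the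
continuous unitary and the continuous positions. There is no zero block, since the representations
are unital. -/
theorem isStandardFamily_of_pieces {n : ℕ} (hn : 0 < n)
    (Ψ : unitInterval → A.alg →⋆ₐ[ℂ] Matrix (Fin q) (Fin q) ℂ) (P : ℕ → Piece A q)
    (h : ∀ i < n, ∀ t : unitInterval, n * (t : ℝ) ∈ Set.Icc (i : ℝ) (i + 1) →
      Ψ t = (P i).rep (Set.projIcc 0 1 zero_le_one (n * t - i))) :
    IsStandardFamily n Ψ := by
  have hn' : (0 : ℝ) < n := by exact_mod_cast hn
  let z : Fin (n + 1) → unitInterval := fun i => ⟨(i : ℕ) / n, by positivity, by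
    rw [div_le_one hn']
    exact_mod_cast Nat.le_of_lt_succ i.2⟩
  refine ⟨z, fun i j hij => ?_, ?_, ?_, fun m => ?_⟩
  · rw [← Subtype.coe_lt_coe]
    exact div_lt_div_of_pos_right (by exact_mod_cast hij) hn'
  · ext; simp [z]
  · ext; simp [z, hn'.ne']
  · let a := z m.castSucc
    let b := z m.succ
    let p : Set.Icc a b → unitInterval := fun t =>
      Set.projIcc 0 1 zero_le_one (n * ((t : unitInterval) : ℝ) - m)
    have hp : Continuous p := continuous_projIcc.comp ((continuous_const.mul
      (continuous_subtype_val.comp continuous_subtype_val)).sub continuous_const)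
    let γ : C(Set.Icc a b, Param q) := (P m).2.comp ⟨p, hp⟩
    refine ⟨⟨fun t => (γ t).1, continuous_fst.comp γ.continuous⟩, (P m).1.1, 0,
      fun i => ⟨fun t => A.pt ((P m).1.2.1 i) ((P m).1.pos (γ t).2 i),
        (A.continuous_pt _).comp (((P m).1.continuous_pos i).comp
          (continuous_snd.comp γ.continuous))⟩, fun t => ?_, fun g t => ?_⟩
    · simp only [ContinuousMap.coe_mk, dim_pt]
      exact (P m).1.2.2
    · have ht : n * ((t : unitInterval) : ℝ) ∈ Set.Icc ((m : ℕ) : ℝ) ((m : ℕ) + 1) := by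
        have h1 : ((m : ℕ) : ℝ) / n ≤ (t : unitInterval) := t.2.1
        have h2 : ((t : unitInterval) : ℝ) ≤ ((m : ℕ) + 1 : ℕ) / n := t.2.2
        rw [div_le_iff₀ hn'] at h1
        rw [le_div_iff₀ hn'] at h2
        push_cast at h2
        constructor <;> linarith
      rw [h m m.2 t ht]
      show model (P m).1 (γ t) g = _
      rw [model_apply]
      congr 2
      exact blockDiagZero_congr (fun i => (A.dim_pt _ _).symm) (fun i => A.cell_heq _ _ _) _ _

/-- The `m`-th point of the uniform partition of `[0, 1]` into `N` intervals. -/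
noncomputable def gridPoint (N m : ℕ) : unitInterval :=
  Set.projIcc 0 1 zero_le_one ((m : ℝ) / N)

theorem dist_gridPoint_le (N m : ℕ) (t : unitInterval) :
    dist t (gridPoint N m) ≤ |(t : ℝ) - m / N| := by
  conv_lhs => rw [← Set.projIcc_val (zero_le_one (α := ℝ)) t]
  refine (((LipschitzWith.projIcc (zero_le_one (α := ℝ))).dist_le_mul _ _)).trans ?_
  rw [Real.dist_eq, NNReal.coe_one, one_mul]

theorem dist_gridPoint_succ_le (N m : ℕ) :
    dist (gridPoint N (m + 1)) (gridPoint N m) ≤ 1 / N := by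
  refine (((LipschitzWith.projIcc (zero_le_one (α := ℝ))).dist_le_mul _ _)).trans ?_
  rw [Real.dist_eq, NNReal.coe_one, one_mul]
  have : ((m + 1 : ℕ) : ℝ) / N - m / N = 1 / N := by push_cast; ring
  rw [this, abs_of_nonneg (by positivity)]

/-- Continuous families of representations can be approximated by standard families with the same
end points, which moreover sweep out neighbourhoods of the spectrum at all grid points. -/
theorem exists_standardFamily (Φ : unitInterval → A.alg →⋆ₐ[ℂ] Matrix (Fin q) (Fin q) ℂ)
    (hΦ : ∀ h, Continuous fun t => Φ t h) {𝓕 : Set A.alg} (h𝓕 : 𝓕.Finite) {ε : ℝ}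
    (hε : 0 < ε) :
    ∃ η > 0, ∃ τ > 0, ∀ N : ℕ, 0 < N → 1 / (N : ℝ) < τ →
      ∃ Ψ : unitInterval → A.alg →⋆ₐ[ℂ] Matrix (Fin q) (Fin q) ℂ,
        (∀ h, Continuous fun t => Ψ t h) ∧ Ψ 0 = Φ 0 ∧ Ψ 1 = Φ 1 ∧
        (∀ t, ∀ h ∈ 𝓕, ‖Ψ t h - Φ t h‖ < ε) ∧ IsStandardFamily (3 * N) Ψ ∧
        ∀ h, (∀ t, Ψ t h = 0) → ∀ m < N, Sweeps η (Φ (gridPoint N m)) h := by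
  obtain ⟨η, hη, τ, hτ, hpieces⟩ := exists_pieces Φ hΦ h𝓕 hε
  refine ⟨η, hη, τ, hτ, fun N hN hNτ => ?_⟩
  -- Grid points are clamped to `[0, 1]`, so the pieces exist and match for every `m`, including
  -- those with `m ≥ N`.
  choose Q hQ0 hQ01 hQ12 hQ2 hQ𝓕 hQs using fun m : ℕ => hpieces (gridPoint N m)
    (gridPoint N (m + 1)) ((dist_gridPoint_succ_le N m).trans_lt hNτ)
  have hN' : (0 : ℝ) < N := by exact_mod_cast hN
  let P : ℕ → Piece A q := fun i => Q (i / 3) (i % 3)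
  have hPQ : ∀ m r, r < 3 → P (3 * m + r) = Q m r := by
    intro m r hr
    show Q ((3 * m + r) / 3) ((3 * m + r) % 3) = _
    rw [show (3 * m + r) / 3 = m by omega, show (3 * m + r) % 3 = r by omega]
  have hP : ∀ i, (P i).rep 1 = (P (i + 1)).rep 0 := by
    intro i
    obtain ⟨m, r, hr, rfl⟩ : ∃ m r, r < 3 ∧ i = 3 * m + r :=
      ⟨i / 3, i % 3, Nat.mod_lt _ (by norm_num), (Nat.div_add_mod i 3).symm⟩
    interval_cases r
    · rw [hPQ m 0 (by norm_num), add_assoc, hPQ m 1 (by norm_num), hQ01]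
    · rw [hPQ m 1 (by norm_num), add_assoc, hPQ m 2 (by norm_num), hQ12]
    · rw [hPQ m 2 (by norm_num), hQ2, show 3 * m + 2 + 1 = 3 * (m + 1) + 0 by ring,
        hPQ (m + 1) 0 (by norm_num), hQ0]
  obtain ⟨Ψ, hΨc, hΨn, hΨ⟩ := exists_concat P hP (3 * N)
  have h3N : (0 : ℝ) < ((3 * N : ℕ) : ℝ) := by exact_mod_cast (by omega : 0 < 3 * N)
  refine ⟨fun t => Ψ ((3 * N : ℕ) * t), fun h => (hΨc h).comp
    (continuous_const.mul continuous_subtype_val), ?_, ?_, fun t h hh => ?_, ?_, ?_⟩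
  · show Ψ (_ * ((0 : unitInterval) : ℝ)) = _
    rw [hΨ 0 (by omega) _ (by simp)]
    have : P 0 = Q 0 0 := hPQ 0 0 (by norm_num)
    rw [this]
    simp [hQ0, gridPoint]
  · show Ψ (_ * ((1 : unitInterval) : ℝ)) = _
    rw [Set.Icc.coe_one, mul_one, hΨn, show 3 * N = 3 * N + 0 from rfl,
      hPQ N 0 (by norm_num), hQ0]
    simp [gridPoint, hN'.ne']
  · obtain ⟨i, hi, hit⟩ : ∃ i < 3 * N, ((3 * N : ℕ) : ℝ) * t ∈ Set.Icc (i : ℝ) (i + 1) := by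
      -- At `t = 1` the floor would give the index `3 * N`, which is out of range; the last piece is
      -- used instead.
      by_cases ht : (t : ℝ) = 1
      · refine ⟨3 * N - 1, by omega, ?_⟩
        rw [ht, mul_one, Nat.cast_sub (by omega : 1 ≤ 3 * N)]
        simp
      · have ht1 : (t : ℝ) < 1 := lt_of_le_of_ne t.2.2 ht
        have hnn : 0 ≤ ((3 * N : ℕ) : ℝ) * t := mul_nonneg h3N.le t.2.1
        refine ⟨⌊((3 * N : ℕ) : ℝ) * t⌋₊, ?_, Nat.floor_le hnn, (Nat.lt_floor_add_one _).le⟩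
        rw [Nat.floor_lt hnn]
        exact mul_lt_of_lt_one_right h3N ht1
    show ‖Ψ _ h - _‖ < ε
    rw [hΨ i hi _ hit]
    obtain ⟨m, r, hr, rfl⟩ : ∃ m r, r < 3 ∧ i = 3 * m + r :=
      ⟨i / 3, i % 3, Nat.mod_lt _ (by norm_num), (Nat.div_add_mod i 3).symm⟩
    rw [hPQ m r hr]
    refine hQ𝓕 m r hr _ t (((dist_gridPoint_le N m t).trans ?_).trans_lt hNτ) h hh
    have hr' : (r : ℝ) ≤ 2 := by exact_mod_cast Nat.le_of_lt_succ hr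
    have hr0 : (0 : ℝ) ≤ r := by positivity
    obtain ⟨h1, h2⟩ := hit
    push_cast at h1 h2
    have e : (t : ℝ) - m / N = (N * t - m) / N := by field_simp
    rw [e, abs_div, abs_of_pos hN']
    refine div_le_div_of_nonneg_right ?_ hN'.le
    rw [abs_le]
    constructor <;> linarith
  · exact isStandardFamily_of_pieces (by omega) _ P fun i hi t ht => hΨ i hi _ ht
  · intro h hh m hm
    refine hQs m h fun t => ?_
    have hlt : 3 * m + 0 < 3 * N := by omega
    have h1 := hΨ (3 * m + 0) hlt ((3 * m + 0 : ℕ) + t) (by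
      constructor
      · linarith [t.2.1]
      · linarith [t.2.2])
    rw [hPQ m 0 (by norm_num), add_sub_cancel_left, Set.projIcc_val] at h1
    rw [← h1]
    have h2 : ((3 * m + 0 : ℕ) : ℝ) + 1 ≤ (3 * N : ℕ) := by exact_mod_cast hlt
    have h3 : (((3 * m + 0 : ℕ) : ℝ) + t) / (3 * N : ℕ) ∈ unitInterval := by
      constructor
      · exact div_nonneg (add_nonneg (Nat.cast_nonneg _) t.2.1) h3N.le
      · rw [div_le_one h3N]
        linarith [t.2.2]
    have h4 := hh ⟨_, h3⟩
    simp only [mul_div_cancel₀ _ h3N.ne'] at h4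
    exact h4

end NCCW

/-! ### Tools for boundary conditions and injectivity. -/

namespace NCCW
variable {A B : NCCW}

/-- A finite-rank linear map kills some nonzero central function supported in a given open
subinterval. -/
theorem exists_bump {W : Type*} [AddCommGroup W] [Module ℂ W] [FiniteDimensional ℂ W]
    (T : A.alg →ₗ[ℂ] W) (j : Fin A.k) {a b : ℝ} (ha : 0 ≤ a) (hab : a < b) (hb : b ≤ 1) :
    ∃ g : A.alg, g ≠ 0 ∧ T g = 0 ∧
      ∀ c s, A.eval g (A.pt c s) ≠ 0 → c = Sum.inr j ∧ a < s ∧ (s : ℝ) < b := by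
  -- The bump `κ` is positive exactly on `(a, b)`. Its polynomial multiples form an
  -- infinite-dimensional space, so a map into a finite-dimensional one kills a nonzero multiple.
  let κ : ℝ → ℝ := fun t => max ((t - a) * (b - t)) 0
  have hκ : Continuous κ := by fun_prop
  have hκ0 : ∀ t, ¬ (a < t ∧ t < b) → κ t = 0 := by
    intro t ht
    refine max_eq_right ?_
    by_contra! hpos
    rcases pos_and_pos_or_neg_and_neg_of_mul_pos hpos with h | h
    · exact ht ⟨by linarith, by linarith⟩
    · linarith
  have hκ1 : ∀ t, a < t → t < b → κ t ≠ 0 := fun t h1 h2 =>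
    (lt_max_of_lt_left (mul_pos (by linarith) (by linarith))).ne'
  let f : Polynomial ℂ → C(unitInterval, ℂ) := fun P =>
    ⟨fun t => (κ t : ℂ) * P.eval ((t : ℝ) : ℂ), by fun_prop⟩
  have hf : ∀ P, f P 0 = 0 ∧ f P 1 = 0 := by
    intro P
    simp only [f, ContinuousMap.coe_mk]
    rw [Set.Icc.coe_zero, Set.Icc.coe_one, hκ0 0 (fun h => by linarith [h.1]),
      hκ0 1 (fun h => by linarith [h.2])]
    simp
  let L : Polynomial ℂ →ₗ[ℂ] A.alg :=
    { toFun := fun P => cen j (f P) (hf P)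
      map_add' := fun P Q => by
        refine ext_of_blk (j := j) (fun t => ?_) (fun j' hj' t => ?_) (funext fun i => ?_)
        · simp only [add_fst, cen_fst_self]; simp [f, mul_add, add_smul]
        · simp only [add_fst, cen_fst_of_ne _ _ _ hj']; simp
        · simp only [add_snd, cen_snd]; simp
      map_smul' := fun c P => by
        refine ext_of_blk (j := j) (fun t => ?_) (fun j' hj' t => ?_) (funext fun i => ?_)
        · simp only [smul_fst, cen_fst_self]; simp [f, smul_smul, mul_left_comm]
        · simp only [smul_fst, cen_fst_of_ne _ _ _ hj']; simp
        · simp only [smul_snd, cen_snd]; simp }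
  obtain ⟨P, hP0, hTP⟩ : ∃ P : Polynomial ℂ, P ≠ 0 ∧ T (L P) = 0 := by
    by_contra! hcon
    have hinj : Function.Injective (T ∘ₗ L) := by
      refine (injective_iff_map_eq_zero _).2 fun P hP => ?_
      by_contra h0
      exact hcon P h0 hP
    have := Module.Finite.of_injective (T ∘ₗ L) hinj
    exact Polynomial.not_finite this
  refine ⟨L P, fun h0 => hP0 ?_, hTP, fun c s hs => ?_⟩
  · refine Polynomial.eq_zero_of_infinite_isRoot P (((Set.Ioo_infinite hab).image
      Complex.ofReal_injective.injOn).mono ?_)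
    rintro _ ⟨t, ht, rfl⟩
    have ht' : t ∈ unitInterval := ⟨ha.trans ht.1.le, ht.2.le.trans hb⟩
    have h1 : (L P).1.1 ⟨t, ht'⟩ j = 0 := by rw [h0]; rfl
    have h2 := congrFun (congrFun ((cen_fst_self j _ (hf P) _).symm.trans h1) ⟨0, A.f_pos j⟩)
      ⟨0, A.f_pos j⟩
    have h3 : f P ⟨t, ht'⟩ = 0 := by simpa using h2
    exact (mul_eq_zero.1 h3).resolve_left (by exact_mod_cast hκ1 t ht.1 ht.2)
  · rcases c with i | j'
    · exact absurd rfl hs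
    · by_cases hj : j' = j
      · subst hj
        refine ⟨rfl, ?_⟩
        by_contra hcon
        have h1 : f P s = 0 := by
          simp only [f, ContinuousMap.coe_mk]
          rw [hκ0 _ hcon]
          simp
        have h2 : (L P).1.1 s j' = 0 := (cen_fst_self _ _ (hf P) s).trans (by rw [h1, zero_smul])
        exact hs h2
      · exact absurd (cen_fst_of_ne _ (hf P) s hj) hs

/-- Changing the components of a `⋆`-homomorphism into `C([0,1], F')`, relative to the end
points. -/
noncomputable def replaceFst (φ : A.alg →⋆ₐ[ℂ] B.alg)
    (Ψ : ∀ j : Fin B.k, unitInterval → A.alg →⋆ₐ[ℂ] Matrix (Fin (B.f j)) (Fin (B.f j)) ℂ)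
    (hc : ∀ j h, Continuous fun t => Ψ j t h) (h0 : ∀ j h, Ψ j 0 h = (φ h).1.1 0 j)
    (h1 : ∀ j h, Ψ j 1 h = (φ h).1.1 1 j) : A.alg →⋆ₐ[ℂ] B.alg where
  toFun h := ⟨(⟨fun t j => Ψ j t h, continuous_pi fun j => hc j h⟩, (φ h).1.2),
    (funext fun j => h0 j h).trans (φ h).2.1, (funext fun j => h1 j h).trans (φ h).2.2⟩
  map_one' := alg_ext (fun t j => (Ψ j t).map_one')
    (fun i => by have e := congrArg (fun b : B.alg => b.1.2 i) φ.map_one'; exact e)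
  map_mul' h h' := alg_ext (fun t j => (Ψ j t).map_mul' h h')
    (fun i => by have e := congrArg (fun b : B.alg => b.1.2 i) (φ.map_mul' h h'); exact e)
  map_zero' := alg_ext (fun t j => (Ψ j t).map_zero')
    (fun i => by have e := congrArg (fun b : B.alg => b.1.2 i) φ.map_zero'; exact e)
  map_add' h h' := alg_ext (fun t j => (Ψ j t).map_add' h h')
    (fun i => by have e := congrArg (fun b : B.alg => b.1.2 i) (φ.map_add' h h'); exact e)
  commutes' c := alg_ext (fun t j => (Ψ j t).commutes' c)
    (fun i => by have e := congrArg (fun b : B.alg => b.1.2 i) (φ.commutes' c); exact e)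
  map_star' h := alg_ext (fun t j => (Ψ j t).map_star' h)
    (fun i => by have e := congrArg (fun b : B.alg => b.1.2 i) (φ.map_star' h); exact e)

theorem norm_lt_of_forall {b : B.alg} {ε : ℝ} (hε : 0 < ε) (h1 : ∀ t j, ‖b.1.1 t j‖ < ε)
    (h2 : ∀ i, ‖b.1.2 i‖ < ε) : ‖b‖ < ε := by
  show max ‖b.1.1‖ ‖b.1.2‖ < ε
  exact max_lt ((ContinuousMap.norm_lt_iff _ hε).2 fun t => (pi_norm_lt_iff hε).2 (h1 t))
    ((pi_norm_lt_iff hε).2 h2)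

theorem exists_dist_gridPoint_le {N : ℕ} (hN : 0 < N) (t : unitInterval) :
    ∃ m < N, (m : ℝ) / N ≤ t ∧ (t : ℝ) ≤ (m + 1) / N := by
  have hN' : (0 : ℝ) < N := by exact_mod_cast hN
  by_cases ht : (t : ℝ) = 1
  · refine ⟨N - 1, by omega, ?_⟩
    rw [ht, Nat.cast_sub (by omega : 1 ≤ N), div_le_one hN', le_div_iff₀ hN']
    simp
  · have ht1 : (t : ℝ) < 1 := lt_of_le_of_ne t.2.2 ht
    have hnn : 0 ≤ (t : ℝ) * N := mul_nonneg t.2.1 hN'.le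
    refine ⟨⌊(t : ℝ) * N⌋₊, ?_, ?_, ?_⟩
    · rw [Nat.floor_lt hnn]
      exact mul_lt_of_lt_one_left hN' ht1
    · rw [div_le_iff₀ hN']
      exact Nat.floor_le hnn
    · rw [le_div_iff₀ hN']
      exact (Nat.lt_floor_add_one _).le

/-- Submultiplicativity gives `‖b‖ ≤ ‖b‖²`, which forces `‖b‖ = 0` or `‖b‖ ≥ 1`. -/
theorem _root_.eq_zero_of_mul_self_eq_of_norm_lt_one {R : Type*} [NormedRing R] {b : R}
    (hb : b * b = b) (h : ‖b‖ < 1) : b = 0 := by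
  by_contra h1
  have h2 : ‖b‖ ≤ ‖b‖ * ‖b‖ := by
    conv_lhs => rw [← hb]
    exact norm_mul_le _ _
  have h3 : 0 < ‖b‖ := norm_pos_iff.2 h1
  nlinarith

set_option synthInstance.maxHeartbeats 200000 in
/-- An element of `A` supported on the discrete part of the spectrum vanishes if it is in the kernel
of a `⋆`-homomorphism that is close to an injective one on the minimal projections there. -/
theorem eq_zero_of_fst_eq_zero {φ ψ : A.alg →⋆ₐ[ℂ] B.alg} (hφ : Function.Injective φ)
    (hclose : ∀ g : A.alg, g.1.1 = 0 → (∃ i, ∃ p : Fin (A.e i),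
      g.1.2 = Pi.single i (Matrix.single p p 1)) →
      ‖φ g - ψ g‖ < 1) {h : A.alg} (h0 : h.1.1 = 0) (hψ : ψ h = 0) : h = 0 := by
  refine alg_ext (fun t j => by rw [h0]; rfl) (fun i => ?_)
  show h.1.2 i = 0
  by_contra hne
  obtain ⟨p, q, hpq⟩ : ∃ p q, h.1.2 i p q ≠ 0 := by
    by_contra! hcon
    exact hne (Matrix.ext hcon)
  let e : Fin (A.e i) → Fin (A.e i) → FinDimCStar A.e := fun r s =>
    Pi.single i (Matrix.single r s 1)
  have he : ∀ r s, e r p * h.1.2 * e q s = h.1.2 i p q • e r s := by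
    intro r s
    ext1 i'
    by_cases hi : i' = i
    · subst hi
      simp [e]
    · simp [e, hi]
  -- A nonzero entry of `h` in block `i` puts all matrix units of that block into the kernels of
  -- `β₀` and `β₁`. Paired with the zero function, they therefore lie in `A`, and the ideal
  -- generated by `h` contains the minimal projection `E p p`.
  have hβ : ∀ β : FinDimCStar A.e →⋆ₐ[ℂ] FinDimCStar A.f, β h.1.2 = 0 → ∀ r s, β (e r s) = 0 := by
    intro β hβ r s
    have h1 := congrArg β (he r s)
    rw [map_mul, map_mul, hβ, mul_zero, zero_mul, map_smul] at h1
    exact (smul_eq_zero.1 h1.symm).resolve_left hpq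
  have hβ₀ := hβ A.β₀ (by rw [← fst_zero, h0]; rfl)
  have hβ₁ := hβ A.β₁ (by rw [← fst_one, h0]; rfl)
  let E : Fin (A.e i) → Fin (A.e i) → A.alg := fun r s =>
    ⟨(0, e r s), (hβ₀ r s).symm, (hβ₁ r s).symm⟩
  have hE : E p p * h * E q p = h.1.2 i p q • E p p := by
    refine alg_ext (fun t j => ?_) (fun i' => congrFun (he p p) i')
    rw [mul_fst, smul_fst]
    exact (mul_zero _).trans (smul_zero (A := Matrix (Fin (A.f j)) (Fin (A.f j)) ℂ) _).symm
  have hEE : E p p * E p p = E p p := by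
    refine Subtype.ext (Prod.ext (mul_zero _) ?_)
    show e p p * e p p = e p p
    rw [← Pi.single_mul]
    simp [e]
  have hψE : ψ (E p p) = 0 := by
    have h1 := congrArg ψ hE
    rw [map_mul, map_mul, hψ, mul_zero, zero_mul, map_smul] at h1
    exact (smul_eq_zero.1 h1.symm).resolve_left hpq
  have hlt : ‖φ (E p p)‖ < 1 := by
    have := hclose (E p p) rfl ⟨i, p, rfl⟩
    rw [hψE] at this
    exact (congrArg norm (sub_zero (φ (E p p)))).symm.trans_lt this
  have hφE : φ (E p p) = 0 := Subtype.ext (eq_zero_of_mul_self_eq_of_norm_lt_one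
    (congrArg Subtype.val ((map_mul φ _ _).symm.trans (congrArg φ hEE))) hlt)
  have hE0 : E p p = 0 := hφ (hφE.trans (map_zero φ).symm)
  have h4 : e p p = 0 := congrArg (fun x : A.alg => x.1.2) hE0
  have h5 := congrFun (congrFun (congrFun h4 i) p) p
  simp [e] at h5

end NCCW

/-! ### Detection at grid points and assembly of the approximating map. -/

namespace NCCW
variable {A B : NCCW}

/-- The finite-dimensional representation of `A` obtained from a `⋆`-homomorphism `A → B` by
evaluation in the `j`-th component at `t`. -/
noncomputable def family (φ : A.alg →⋆ₐ[ℂ] B.alg) (j : Fin B.k) (t : unitInterval) :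
    A.alg →⋆ₐ[ℂ] Matrix (Fin (B.f j)) (Fin (B.f j)) ℂ :=
  StarAlgHom.comp (B.evalHom (Sum.inr ⟨j, t⟩)) φ

theorem continuous_family (φ : A.alg →⋆ₐ[ℂ] B.alg) (j : Fin B.k) (h : A.alg) :
    Continuous fun t => family φ j t h := (continuous_apply j).comp (φ h).1.1.continuous

/-- An injective `⋆`-homomorphism into `B` detects a nonzero function supported in a given open
subinterval on the nondiscrete part of `B`. -/
theorem exists_bump_family_ne_zero (φ : A.alg →⋆ₐ[ℂ] B.alg) (j : Fin A.k) {a b : ℝ} (ha : 0 ≤ a)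
    (hab : a < b) (hb : b ≤ 1) :
    ∃ g : A.alg, (∀ c s, A.eval g (A.pt c s) ≠ 0 → c = Sum.inr j ∧ a < s ∧ (s : ℝ) < b) ∧
      (Function.Injective φ → ∃ j' t, family φ j' t g ≠ 0) := by
  let T : A.alg →ₗ[ℂ] FinDimCStar B.e :=
    { toFun := fun h => (φ h).1.2
      map_add' := fun x y => congrArg (fun z : B.alg => z.1.2) (map_add φ x y)
      map_smul' := fun c x => congrArg (fun z : B.alg => z.1.2) (map_smul φ c x) }
  obtain ⟨g, hg0, hTg, hg⟩ := exists_bump T j ha hab hb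
  refine ⟨g, hg, fun hφ => ?_⟩
  by_contra! hcon
  refine hg0 (hφ (Eq.trans ?_ (map_zero φ).symm))
  refine alg_ext (fun t j' => hcon j' t) (fun i => congrFun hTg i)

/-- On all sufficiently fine grids, a nonvanishing element is detected at a grid point. -/
theorem eventually_exists_gridPoint {X : Type*} [TopologicalSpace X] [T1Space X] [Zero X]
    {f : unitInterval → X} (hf : Continuous f) {t : unitInterval} (ht : f t ≠ 0) :
    ∀ᶠ N : ℕ in Filter.atTop, ∃ m < N, f (gridPoint N m) ≠ 0 := by
  obtain ⟨τ, hτ, hball⟩ := Metric.mem_nhds_iff.1 (hf.continuousAt.eventually_ne ht)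
  filter_upwards [Filter.eventually_gt_atTop 0,
    tendsto_one_div_atTop_nhds_zero_nat.eventually_lt_const hτ] with N hN hNτ
  have hN' : (0 : ℝ) < N := by exact_mod_cast hN
  obtain ⟨m, hm, h1, h2⟩ := exists_dist_gridPoint_le hN t
  refine ⟨m, hm, hball ?_⟩
  rw [Metric.mem_ball, dist_comm]
  refine ((dist_gridPoint_le N m t).trans ?_).trans_lt hNτ
  rw [add_div] at h2
  rw [abs_of_nonneg (by linarith)]
  linarith

set_option synthInstance.maxHeartbeats 200000 in
theorem injective_of_map_eq_zero {ψ : A.alg →⋆ₐ[ℂ] B.alg} (hψ : ∀ h, ψ h = 0 → h = 0) :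
    Function.Injective ψ := fun x y hxy =>
  sub_eq_zero.1 (hψ _ ((map_sub ψ x y).trans (sub_eq_zero.2 hxy)))

end NCCW

theorem mainTheorem3 (A B : NCCW) (𝓕 : Set A.alg) (h𝓕 : 𝓕.Finite) (ε : ℝ) (hε : 0 < ε)
    (φ : A.alg →⋆ₐ[ℂ] B.alg) :
    ∃ (n : ℕ) (ψ : A.alg →⋆ₐ[ℂ] B.alg),
      NCCW.IsStandard A B n ψ.toNonUnitalStarAlgHom ∧
      (∀ h ∈ 𝓕, ‖φ h - ψ h‖ < ε) ∧
      (Function.Injective φ → Function.Injective ψ) := by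
  -- These minimal projections on the discrete part join `𝓕`, with tolerance `min ε 1`, so that
  -- injectivity at the points `δ_i` survives the approximation.
  let 𝓔 : Set A.alg := {g | g.1.1 = 0 ∧ ∃ i, ∃ p : Fin (A.e i),
    g.1.2 = Pi.single i (Matrix.single p p 1)}
  have h𝓔 : 𝓔.Finite := by
    refine Set.Finite.of_injOn (f := fun g : A.alg => g.1.2)
      (t := Set.range fun y : Σ i, Fin (A.e i) =>
        (Pi.single y.1 (Matrix.single y.2 y.2 1) : FinDimCStar A.e)) ?_ ?_ (Set.finite_range _)
    · rintro g ⟨-, i, p, hg⟩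
      exact ⟨⟨i, p⟩, hg.symm⟩
    · rintro g ⟨hg, -⟩ g' ⟨hg', -⟩ h
      exact Subtype.ext (Prod.ext (hg.trans hg'.symm) h)
  have hε' : 0 < min ε 1 := lt_min hε one_pos
  -- The radii `η` and `τ` do not depend on the grid. Hence `η` can fix the mesh `1 / M` on `sp(A)`
  -- and its bumps `g`, and the grid size `N`, common to all components, can be taken large enough
  -- to detect them.
  choose η hη τ hτ hΨ using fun j => NCCW.exists_standardFamily (NCCW.family φ j)
    (NCCW.continuous_family φ j) (h𝓕.union h𝓔) hε'
  obtain ⟨M, hM, hMη⟩ : ∃ M : ℕ, 0 < M ∧ ∀ j, 1 / (M : ℝ) < η j :=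
    ((Filter.eventually_gt_atTop 0).and (Filter.eventually_all.2 fun j =>
      tendsto_one_div_atTop_nhds_zero_nat.eventually_lt_const (hη j))).exists
  have hM' : (0 : ℝ) < M := by exact_mod_cast hM
  choose g hg hgφ using fun (j : Fin A.k) (r : Fin M) => NCCW.exists_bump_family_ne_zero φ j
    (a := ((r : ℕ) : ℝ) / M) (b := (((r : ℕ) : ℝ) + 1) / M) (by positivity)
    (div_lt_div_of_pos_right (lt_add_one _) hM')
    (by rw [div_le_one hM']; exact_mod_cast r.2)
  obtain ⟨N, hN, hNτ, hNg⟩ : ∃ N : ℕ, 0 < N ∧ (∀ j, 1 / (N : ℝ) < τ j) ∧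
      ∀ j r, Function.Injective φ → ∃ m < N, ∃ j',
        NCCW.family φ j' (NCCW.gridPoint N m) (g j r) ≠ 0 := by
    refine ((Filter.eventually_gt_atTop 0).and ((Filter.eventually_all.2 fun j =>
      tendsto_one_div_atTop_nhds_zero_nat.eventually_lt_const (hτ j)).and
      (Filter.eventually_all.2 fun j => Filter.eventually_all.2 fun r => ?_))).exists
    by_cases hφ : Function.Injective φ
    · obtain ⟨j', t, ht⟩ := hgφ j r hφ
      filter_upwards [NCCW.eventually_exists_gridPoint
        (NCCW.continuous_family φ j' (g j r)) ht] with N hN _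
      obtain ⟨m, hm, h⟩ := hN
      exact ⟨m, hm, j', h⟩
    · exact Filter.Eventually.of_forall fun _ h => absurd h hφ
  choose Ψ hΨc hΨ0 hΨ1 hΨ𝓕 hΨstd hΨs using fun j => hΨ j N hN (hNτ j)
  let ψ := NCCW.replaceFst φ Ψ hΨc (fun j h => by rw [hΨ0]; rfl) (fun j h => by rw [hΨ1]; rfl)
  have hclose : ∀ h ∈ 𝓕 ∪ 𝓔, ‖φ h - ψ h‖ < min ε 1 := by
    intro h hh
    refine NCCW.norm_lt_of_forall hε' (fun t j => ?_) (fun i => ?_)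
    · show ‖(φ h).1.1 t j - Ψ j t h‖ < _
      rw [norm_sub_rev]
      exact hΨ𝓕 j t h hh
    · show ‖(φ h).1.2 i - (φ h).1.2 i‖ < _
      rw [sub_self, norm_zero]
      exact hε'
  refine ⟨3 * N, ψ, fun j => hΨstd j, fun h hh =>
    (hclose h (Or.inl hh)).trans_le (min_le_left _ _), fun hφ => ?_⟩
  refine NCCW.injective_of_map_eq_zero fun h hh => ?_
  refine NCCW.eq_zero_of_fst_eq_zero hφ (fun e he1 he2 =>
    (hclose e (Or.inr ⟨he1, he2⟩)).trans_le (min_le_right _ _)) ?_ hh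
  refine ContinuousMap.ext fun t => funext fun j => ?_
  obtain ⟨r, hr, hrt1, hrt2⟩ := NCCW.exists_dist_gridPoint_le hM t
  obtain ⟨m, hm, j', hj'⟩ := hNg j ⟨r, hr⟩ hφ
  have hΨh : ∀ t', Ψ j' t' h = 0 := fun t' =>
    congrArg (fun b : B.alg => b.1.1 t' j') hh
  -- The detected bump provides a spectral point `s` in the same cell of length `1 / M < η j'` as
  -- `t`, so the loop at that grid point passes through `t`.
  obtain ⟨c, s, hcs, hsweep⟩ := hΨs j' h hΨh m hm (g j ⟨r, hr⟩) hj'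
  obtain ⟨rfl, hs1, hs2⟩ := hg j ⟨r, hr⟩ c s hcs
  refine hsweep t ((abs_le.2 ⟨?_, ?_⟩).trans (hMη j').le)
  · have : (r : ℝ) / M + 1 / M = (r + 1) / M := by ring
    simp only at hs1 hs2
    linarith
  · have : (r : ℝ) / M + 1 / M = (r + 1) / M := by ring
    simp only at hs1 hs2
    linarith
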